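/- Fix $n$. For $k\in\mathbb Z$ let $\mathcal M_k$ be the set of closed cubes $\prod_{i=1}^n[a_i2^{-k},(a_i+1)2^{-k}]$ with $a\in\mathbb Z^n$, and let $\mathcal M=\bigcup_{k\in\mathbb Z}\mathcal M_k$. Let $B_0,B_1,\dots$ be the standard enumeration of the open balls of $\mathbb R^n$ (Euclidean metric) with rational center and rational radius $\ge 0$, and let $\rho:\mathbb Z\times\mathbb Q^n\to\mathbb N$ be any computable bijection. A *total-information name* of a closed set $F\subseteq\mathbb R^n$ is a sequence $\langle p,q\rangle=(p(0),q(0),p(1),q(1),\dots)\in\mathbb N^{\mathbb N}$ such that $F=\mathbb R^n\setminus\bigcup_{i\in\operatorname{ran}(p)}B_i$ and, for every $i$, $i+1\in\operatorname{ran}(q)$ if and only if $B_i\cap F\neq\emptyset$. A sequence $s\in\mathbb N^{\mathbb N}$ is a name of the family of cubes $\bigcup_{k\in\mathbb Z}\{Q\in\mathcal M_k : s(\rho(k,c_Q))=1\}$, where $c_Q$ is the center of $Q$. Let $\mathrm{CUBE}$ be the multi-valued function that assigns to a nonempty closed set $F\subseteq\mathbb R^n$ all families $\mathcal F\subseteq\mathcal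 M$ such that 1. $\bigcup_{Q\in\mathcal F}Q=\mathbb R^n\setminus F$; 2. $\operatorname{int}(Q)\cap\operatorname{int}(Q')=\emptyset$ for all distinct $Q,Q'\in\mathcal F$; 3. $\tfrac12\operatorname{diam}(Q)<d(Q,F)<5\operatorname{diam}(Q)$ for every $Q\in\mathcal F$, where $d(Q,F)=\inf\{d(x,y): x\in Q,\ y\in F\}$. Then $\mathrm{CUBE}$ is well defined, that is, $\mathrm{CUBE}(F)\neq\emptyset$ for every nonempty closed $F\subseteq\mathbb R^n$, and it is computable: there is a Type-2 machine (one-way read-only input tape, one-way write-only output tape, work tape) which, given any total-information name of any nonempty closed set $F\subseteq\mathbb R^n$ on its input tape, writes on its output tape a name of some family in $\mathrm{CUBE}(F)$. -/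

import Mathlib

/-! ### Computability on Baire space -/

/-- The Baire space of infinite sequences of natural numbers. -/
abbrev Baire : Type := ℕ → ℕ

/-- A Type-2 machine: a machine with a one-way read-only input tape holding an infinite sequence of
natural numbers, a work tape, and a one-way write-only output tape. The control state and the
contents of the work tape are kept together as a finite word over `ℕ`. In one step, from the current
work word and the symbol under the input head, the machine computes a new work word, possibly a
symbol to be appended to the output tape, and whether the input head advances by one cell. As only
computability matters here, and not cost, a single step may do any amount of ordinary (finite)
computation on the work tape, that is, it is a computable function in the usual sense. -/
structure Type2Machine where
  start : List ℕ
  step : List ℕ → ℕ → List ℕ × Option ℕ × Bool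
  computable_step : Computable₂ step

/-- A configuration: the work word, the position of the input head, and the finite word written on
the output tape so far. -/
structure Type2Machine.Config where
  work : List ℕ
  head : ℕ
  output : List ℕ

/-- One step of the machine on the input `p`. -/
def Type2Machine.next (M : Type2Machine) (p : Baire) (c : Type2Machine.Config) :
    Type2Machine.Config :=
  let r := M.step c.work (p c.head)
  { work := r.1
    head := if r.2.2 then c.head + 1 else c.head
    output := c.output ++ r.2.1.toList }

/-- The configuration after `t` steps on the input `p`. -/
def Type2Machine.run (M : Type2Machine) (p : Baire) (t : ℕ) : Type2Machine.Config :=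
  (M.next p)^[t] { work := M.start, head := 0, output := [] }

/-- On input `p` the machine writes the infinite sequence `q` on its output tape. -/
def Type2Machine.Writes (M : Type2Machine) (p q : Baire) : Prop :=
  ∀ n : ℕ, ∃ t : ℕ, (M.run p t).output[n]? = some (q n)

/-- A partial function on Baire space is computable if some Type-2 machine writes `F p` for each
input `p` in the domain of `F`. -/
def IsType2Computable (F : Baire →. Baire) : Prop :=
  ∃ M : Type2Machine, ∀ p q : Baire, q ∈ F p → M.Writes p q

/-! ### Represented spaces and problems -/

/-- A representation of `X`: a partial surjection from Baire space onto `X`, given by its graph: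
`IsName p x` says that `p` is a name of `x`. -/
structure SpaceRepresentation (X : Type*) where
  IsName : Baire → X → Prop
  unique : ∀ {p x y}, IsName p x → IsName p y → x = y
  surjective : ∀ x, ∃ p, IsName p x

/-- The pairing `⟨p, q⟩ = p 0, q 0, p 1, q 1, …` on Baire space. -/
def Baire.pair (p q : Baire) : Baire := fun m => if m % 2 = 0 then p (m / 2) else q (m / 2)

theorem Baire.pair_even (p q : Baire) (m : ℕ) : Baire.pair p q (2 * m) = p m := by
  simp [Baire.pair]

theorem Baire.pair_odd (p q : Baire) (m : ℕ) : Baire.pair p q (2 * m + 1) = q m := by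
  have h : (2 * m + 1) / 2 = m := by omega
  simp [Baire.pair, Nat.add_mod, h]

theorem Baire.pair_injective {p q p' q' : Baire} (h : Baire.pair p q = Baire.pair p' q') :
    p = p' ∧ q = q' :=
  ⟨funext fun m => by rw [← Baire.pair_even p q, h, Baire.pair_even],
    funext fun m => by rw [← Baire.pair_odd p q, h, Baire.pair_odd]⟩

/-- The meet `δ₁ ∧ δ₂`: a name of `x` is a pair of a `δ₁`-name of `x` and a `δ₂`-name of `x`. -/
def SpaceRepresentation.meet {X : Type*} (δ₁ δ₂ : SpaceRepresentation X) : SpaceRepresentation X where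
  IsName s x := ∃ p q, s = Baire.pair p q ∧ δ₁.IsName p x ∧ δ₂.IsName q x
  unique := by
    rintro s x y ⟨p, q, rfl, hx, -⟩ ⟨p', q', h, hy, -⟩
    obtain ⟨rfl, -⟩ := Baire.pair_injective h
    exact δ₁.unique hx hy
  surjective x := by
    obtain ⟨p, hp⟩ := δ₁.surjective x
    obtain ⟨q, hq⟩ := δ₂.surjective x
    exact ⟨_, p, q, rfl, hp, hq⟩

/-- A problem (multi-valued partial function) from `X` to `Y`: `f x` is the set of results for the
instance `x`. -/
abbrev Problem (X Y : Type*) : Type _ := X → Set Y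

/-- The admissible instances of a problem. -/
def Problem.dom {X Y : Type*} (f : Problem X Y) : Set X := {x | (f x).Nonempty}

/-- `F` is a `(δ, γ)`-realizer of the problem `f`. -/
def IsRealizer {X Y : Type*} (δ : SpaceRepresentation X) (γ : SpaceRepresentation Y) (f : Problem X Y)
    (F : Baire →. Baire) : Prop :=
  ∀ p x, δ.IsName p x → x ∈ Problem.dom f → ∃ q ∈ F p, ∃ y ∈ f x, γ.IsName q y

/-- The problem `f` is `(δ, γ)`-computable: it has a computable realizer. -/
def Problem.IsComputable {X Y : Type*} (δ : SpaceRepresentation X) (γ : SpaceRepresentation Y)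
    (f : Problem X Y) : Prop :=
  ∃ F : Baire →. Baire, IsType2Computable F ∧ IsRealizer δ γ f F

/-! ### Canonical numberings of the integers, of the rationals and of rational vectors -/

/-- The numbering `⟨i, j⟩ ↦ i - j` of the integers. -/
def intNum (m : ℕ) : ℤ := (m.unpair.1 : ℤ) - (m.unpair.2 : ℤ)

/-- The numbering `⟨i, j⟩ ↦ intNum i / (j + 1)` of the rational numbers. -/
def ratNum (m : ℕ) : ℚ := (intNum m.unpair.1 : ℚ) / ((m.unpair.2 : ℚ) + 1)

/-- The numbering of `ℚⁿ`: the `i`-th coordinate of the vector with number `m` is the rational number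
whose number is the `i`-th entry of the finite list coded by `m` (`0` if there is no such entry). -/
def ratVecNum (n m : ℕ) : Fin n → ℚ := fun i =>
  ratNum ((Denumerable.ofNat (List ℕ) m).getD i 0)

/-- The numbering `⟨i, j⟩ ↦ i / (j + 1)` of the nonnegative rational numbers. -/
def nonnegRatNum (m : ℕ) : ℚ := (m.unpair.1 : ℚ) / ((m.unpair.2 : ℚ) + 1)

theorem intNum_surjective : Function.Surjective intNum := fun z =>
  ⟨Nat.pair z.toNat (-z).toNat, by simp only [intNum, Nat.unpair_pair]; omega⟩

theorem ratNum_surjective : Function.Surjective ratNum := fun r => by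
  obtain ⟨a, ha⟩ := intNum_surjective r.num
  refine ⟨Nat.pair a (r.den - 1), ?_⟩
  have h : ((r.den - 1 : ℕ) : ℚ) + 1 = r.den := by
    have := r.den_pos
    exact_mod_cast Nat.sub_add_cancel this
  simp only [ratNum, Nat.unpair_pair, ha, h]
  exact Rat.num_div_den r

theorem ratVecNum_surjective (n : ℕ) : Function.Surjective (ratVecNum n) := fun v => by
  choose c hc using fun i => ratNum_surjective (v i)
  refine ⟨Encodable.encode (List.ofFn c), funext fun i => ?_⟩
  simp [ratVecNum, Denumerable.ofNat_encode, hc]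

theorem nonnegRatNum_surjective {r : ℚ} (hr : 0 ≤ r) : ∃ m, nonnegRatNum m = r := by
  refine ⟨Nat.pair r.num.toNat (r.den - 1), ?_⟩
  have h : ((r.den - 1 : ℕ) : ℚ) + 1 = r.den := by
    have := r.den_pos
    exact_mod_cast Nat.sub_add_cancel this
  have h' : ((r.num.toNat : ℕ) : ℚ) = (r.num : ℚ) := by
    have := Int.toNat_of_nonneg (Rat.num_nonneg.2 hr)
    exact_mod_cast this
  simp only [nonnegRatNum, Nat.unpair_pair, h, h']
  exact Rat.num_div_den r

/-! ### Closed subsets of Euclidean space given with total information -/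

/-- A rational vector as a point of Euclidean space. -/
noncomputable def ratPoint {n : ℕ} (v : Fin n → ℚ) : EuclideanSpace ℝ (Fin n) :=
  WithLp.toLp 2 fun i => (v i : ℝ)

/-- The standard enumeration `B₀, B₁, …` of the rational open balls `B(a, r)` with `a ∈ ℚⁿ` and
`r ∈ ℚ`, `r ≥ 0` (so the empty set occurs, as a ball of radius `0`). -/
noncomputable def ratBall (n i : ℕ) : Set (EuclideanSpace ℝ (Fin n)) :=
  Metric.ball (ratPoint (ratVecNum n i.unpair.1)) (nonnegRatNum i.unpair.2 : ℝ)

theorem denseRange_ratPoint (n : ℕ) : DenseRange (ratPoint (n := n)) := by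
  have h : DenseRange fun (v : Fin n → ℚ) (i : Fin n) => (v i : ℝ) :=
    DenseRange.piMap fun _ => Rat.denseRange_cast
  have hc : Continuous (WithLp.toLp 2 : (Fin n → ℝ) → EuclideanSpace ℝ (Fin n)) :=
    PiLp.continuous_toLp 2 _
  have hs : Function.Surjective (WithLp.toLp 2 : (Fin n → ℝ) → EuclideanSpace ℝ (Fin n)) :=
    WithLp.toLp_surjective 2
  exact hs.denseRange.comp h hc

theorem exists_ratBall {n : ℕ} {U : Set (EuclideanSpace ℝ (Fin n))} (hU : IsOpen U)
    {x : EuclideanSpace ℝ (Fin n)} (hx : x ∈ U) : ∃ i, x ∈ ratBall n i ∧ ratBall n i ⊆ U := by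
  obtain ⟨ε, hε, hb⟩ := Metric.isOpen_iff.1 hU x hx
  obtain ⟨r, hr0, hr⟩ := exists_rat_btwn (half_pos hε)
  obtain ⟨v, hv⟩ := (denseRange_ratPoint n).exists_dist_lt x hr0
  obtain ⟨a, rfl⟩ := ratVecNum_surjective n v
  obtain ⟨b, rfl⟩ := nonnegRatNum_surjective (r := r) (by exact_mod_cast hr0.le)
  refine ⟨Nat.pair a b, ?_, fun y hy => hb ?_⟩
  · simpa [ratBall] using hv
  · simp only [ratBall, Nat.unpair_pair, Metric.mem_ball] at hy ⊢
    have := dist_triangle_right y x (ratPoint (ratVecNum n a))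
    linarith

theorem exists_ratBall_eq_empty (n : ℕ) : ∃ i, ratBall n i = ∅ := by
  obtain ⟨b, hb⟩ := nonnegRatNum_surjective (le_refl (0 : ℚ))
  exact ⟨Nat.pair 0 b, by simp [ratBall, hb]⟩

/-- Negative information: `p` is a name of `F` if `F` is the complement of the union of the balls
`B_i` with `i` in the range of `p`. -/
def negativeRep (n : ℕ) :
    SpaceRepresentation (TopologicalSpace.Closeds (EuclideanSpace ℝ (Fin n))) where
  IsName p F := (F : Set (EuclideanSpace ℝ (Fin n))) = (⋃ i ∈ Set.range p, ratBall n i)ᶜ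
  unique h h' := TopologicalSpace.Closeds.ext (h.trans h'.symm)
  surjective F := by
    classical
    obtain ⟨e, he⟩ := exists_ratBall_eq_empty n
    refine ⟨fun m => if ratBall n m ⊆ (F : Set _)ᶜ then m else e, ?_⟩
    rw [eq_compl_comm]
    refine Set.Subset.antisymm (fun x hx => ?_) (fun x hx => ?_)
    · simp only [Set.mem_iUnion, Set.mem_range, exists_prop] at hx
      obtain ⟨i, ⟨m, rfl⟩, hx⟩ := hx
      split_ifs at hx with h
      · exact h hx
      · simp [he] at hx
    · obtain ⟨i, hi, hi'⟩ := exists_ratBall F.isClosed.isOpen_compl hx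
      simp only [Set.mem_iUnion, Set.mem_range, exists_prop]
      exact ⟨i, ⟨i, if_pos hi'⟩, hi⟩

/-- Positive information: `p` is a name of `F` if it enumerates exactly the balls that meet `F`
(`i + 1` stands for `B_i`, and `0` for no information). -/
def positiveRep (n : ℕ) :
    SpaceRepresentation (TopologicalSpace.Closeds (EuclideanSpace ℝ (Fin n))) where
  IsName p F := ∀ i, i + 1 ∈ Set.range p ↔ (ratBall n i ∩ F).Nonempty
  unique := by
    have key : ∀ (p : Baire) (F G : TopologicalSpace.Closeds (EuclideanSpace ℝ (Fin n))),
        (∀ i, i + 1 ∈ Set.range p ↔ (ratBall n i ∩ F).Nonempty) →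
        (∀ i, i + 1 ∈ Set.range p ↔ (ratBall n i ∩ G).Nonempty) → ∀ x ∈ F, x ∈ G := by
      intro p F G hF hG x hx
      by_contra hxG
      obtain ⟨i, hi, hi'⟩ := exists_ratBall G.isClosed.isOpen_compl hxG
      obtain ⟨y, hy, hyG⟩ := (hG i).1 ((hF i).2 ⟨x, hi, hx⟩)
      exact hi' hy hyG
    intro p F G hF hG
    exact SetLike.ext fun x => ⟨key p F G hF hG x, key p G F hG hF x⟩
  surjective F := by
    classical
    refine ⟨fun m => if (ratBall n (m - 1) ∩ F).Nonempty then m else 0, fun i => ?_⟩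
    constructor
    · rintro ⟨m, hm⟩
      dsimp only at hm
      split_ifs at hm with h
      · subst hm
        simpa using h
    · intro h
      exact ⟨i + 1, by simpa using h⟩

/-- Total information `ψ`: a name is a pair of a negative name and a positive name. -/
def totalRep (n : ℕ) : SpaceRepresentation (TopologicalSpace.Closeds (EuclideanSpace ℝ (Fin n))) :=
  (negativeRep n).meet (positiveRep n)

/-! ### Dyadic cubes -/

/-- The closed cube `∏ i, [a i * 2⁻ᵏ, (a i + 1) * 2⁻ᵏ]`. -/
def dyadicCube {n : ℕ} (k : ℤ) (a : Fin n → ℤ) : Set (EuclideanSpace ℝ (Fin n)) :=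
  {x | ∀ i, (a i : ℝ) * 2 ^ (-k) ≤ x i ∧ x i ≤ ((a i : ℝ) + 1) * 2 ^ (-k)}

/-- The center of `dyadicCube k a`. -/
def dyadicCenter {n : ℕ} (k : ℤ) (a : Fin n → ℤ) : Fin n → ℚ :=
  fun i => ((a i : ℚ) + 1 / 2) * 2 ^ (-k)

theorem dyadicCenter_injective {n : ℕ} (k : ℤ) :
    Function.Injective (dyadicCenter (n := n) k) := fun a b h => funext fun i => by
  have h2 : (2 : ℚ) ^ (-k) ≠ 0 := by positivity
  have := mul_right_cancel₀ h2 (congrFun h i)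
  exact_mod_cast add_right_cancel this

/-- The collection `𝓜` of all dyadic cubes of `ℝⁿ`, of all sizes `2⁻ᵏ`, `k ∈ ℤ`. -/
def DyadicCubes (n : ℕ) : Set (Set (EuclideanSpace ℝ (Fin n))) :=
  {Q | ∃ (k : ℤ) (a : Fin n → ℤ), Q = dyadicCube k a}

/-- The bijection `ρ : ℤ × ℚⁿ → ℕ` is computable (with respect to the canonical numberings). -/
def IsComputableCoding {n : ℕ} (ρ : ℤ × (Fin n → ℚ) ≃ ℕ) : Prop :=
  ∃ g : ℕ → ℕ → ℕ, Computable₂ g ∧ ∀ a b, ρ (intNum a, ratVecNum n b) = g a b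

/-- The representation of families of dyadic cubes by (encoded) characteristic functions: `p` names
the family of the cubes `Q` with side `2⁻ᵏ` and center `c` such that `p (ρ (k, c)) = 1`. -/
def cubesRep {n : ℕ} (ρ : ℤ × (Fin n → ℚ) ≃ ℕ) : SpaceRepresentation (Set (DyadicCubes n)) where
  IsName p 𝓕 := 𝓕 = {Q : DyadicCubes n | ∃ (k : ℤ) (a : Fin n → ℤ),
    (Q : Set (EuclideanSpace ℝ (Fin n))) = dyadicCube k a ∧ p (ρ (k, dyadicCenter k a)) = 1}
  unique h h' := h.trans h'.symm
  surjective 𝓕 := by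
    classical
    refine ⟨fun m => if ∃ (k : ℤ) (a : Fin n → ℤ), ρ (k, dyadicCenter k a) = m ∧
      ∃ Q ∈ 𝓕, (Q : Set (EuclideanSpace ℝ (Fin n))) = dyadicCube k a then 1 else 0, ?_⟩
    ext Q
    constructor
    · intro hQ
      obtain ⟨k, a, h⟩ := Q.2
      exact ⟨k, a, h, if_pos ⟨k, a, rfl, Q, hQ, h⟩⟩
    · rintro ⟨k, a, hQ, hp⟩
      dsimp only at hp
      split_ifs at hp with h
      · obtain ⟨k', a', hρ, Q', hQ', h'⟩ := h
        have h1 := ρ.injective hρ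
        simp only [Prod.mk.injEq] at h1
        obtain ⟨rfl, h1⟩ := h1
        obtain rfl := dyadicCenter_injective k' h1
        rwa [Subtype.ext (hQ.trans h'.symm)]

/-! ### The decomposition problem -/

/-- The Euclidean distance `inf {d(x, y) | x ∈ A, y ∈ B}` of two sets. -/
noncomputable def setDist {n : ℕ} (A B : Set (EuclideanSpace ℝ (Fin n))) : ℝ :=
  sInf (Set.image2 dist A B)

/-- The problem `CUBE`: the instances are the nonempty closed sets `F ⊆ ℝⁿ`, and the results for `F`
are the families of dyadic cubes with union `ℝⁿ \ F` and with pairwise disjoint interiors in which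
each cube `Q` satisfies `diam Q / 2 < d(Q, F) < 5 * diam Q`. -/
def CUBE (n : ℕ) :
    Problem (TopologicalSpace.Closeds (EuclideanSpace ℝ (Fin n))) (Set (DyadicCubes n)) :=
  fun F => {𝓕 : Set (DyadicCubes n) | (F : Set (EuclideanSpace ℝ (Fin n))).Nonempty ∧
    (⋃ Q ∈ 𝓕, (Q : Set (EuclideanSpace ℝ (Fin n)))) = (F : Set (EuclideanSpace ℝ (Fin n)))ᶜ ∧
    (∀ Q ∈ 𝓕, ∀ Q' ∈ 𝓕, Q ≠ Q' →
      interior (Q : Set (EuclideanSpace ℝ (Fin n))) ∩ interior (Q' : Set _) = ∅) ∧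
    ∀ Q ∈ 𝓕,
      1 / 2 * Metric.diam (Q : Set (EuclideanSpace ℝ (Fin n))) <
          setDist (Q : Set (EuclideanSpace ℝ (Fin n))) F ∧
        setDist (Q : Set (EuclideanSpace ℝ (Fin n))) F <
          5 * Metric.diam (Q : Set (EuclideanSpace ℝ (Fin n)))}

/-! Let D be the diameter of a dyadic cube and c its center. Comparing d(c, F) with a number exactly
is not decidable from a name of F, but a test that may answer "far" when d(c, F) > 3D/2 and "near"
when d(c, F) < 5D/2 can be carried out, because the two cases overlap. The family consists of the
cubes that test far and whose parents test near.

The constants fit together as follows (`IsDistanceTest`). A far cube lies within D/2 of c, so its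
distance from F is at least D > D/2. The center of the parent is a corner of the cube, so a near
parent puts that corner at distance less than (5/2)(2D) = 5D from F. If the parent tests far, its
center is more than 3D from F; the centers differ by D/2, so d(c, F) > 5D/2 and the cube tests far
too. Hence, along the chain of cubes around a point outside F, farness passes to smaller cubes;
small cubes are far and large ones near, so the chain has exactly one far cube with a near parent.
This gives covering and disjoint interiors (`maximalCubes_mem_CUBE`), and membership of a cube
depends on two tests only.

For the test, choose rationals e₁ < e₂ strictly between 3√n/2 and 5√n/2. If the ball of radius e₂2⁻ᵏ
about c meets F, the positive information eventually says so. If it does not, compactness gives a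
finite certificate, from the negative information, that d(c, F) ≥ e₁2⁻ᵏ (`exists_isFarCertificate`).
Running both searches and keeping the first outcome always terminates (`exists_outcome`). The
outcome may depend on the name, which a multi-valued problem permits.

Dimension 0 is separate: all diameters vanish, but a nonempty F is the whole space and the empty
family works. -/

/-! ### Primitive recursive functions with rational values -/

/-- A rational-valued function that is primitive recursive with respect to the numbering `ratNum`. -/
def PrimrecRat {α : Type*} [Primcodable α] (f : α → ℚ) : Prop :=
  ∃ h : α → ℕ, Primrec h ∧ ∀ a, ratNum (h a) = f a

namespace PrimrecRat

variable {α β : Type*} [Primcodable α] [Primcodable β] {f g : α → ℚ}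

theorem of_fraction {u v w : α → ℕ} (hu : Primrec u) (hv : Primrec v) (hw : Primrec w)
    (h : ∀ a, f a = ((u a : ℚ) - v a) / (w a + 1)) : PrimrecRat f :=
  ⟨fun a => Nat.pair (Nat.pair (u a) (v a)) (w a),
    Primrec₂.natPair.comp (Primrec₂.natPair.comp hu hv) hw,
    fun a => by simp [ratNum, intNum, h]⟩

theorem exists_fraction (hf : PrimrecRat f) : ∃ u v w : α → ℕ, Primrec u ∧ Primrec v ∧ Primrec w ∧
    ∀ a, f a = ((u a : ℚ) - v a) / (w a + 1) := by
  obtain ⟨h, hh, e⟩ := hf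
  have h1 := Primrec.unpair.comp hh
  have h2 := Primrec.unpair.comp (Primrec.fst.comp h1)
  exact ⟨_, _, _, Primrec.fst.comp h2, Primrec.snd.comp h2, Primrec.snd.comp h1,
    fun a => by simp [← e, ratNum, intNum]⟩

theorem of_eq (hf : PrimrecRat f) (h : ∀ a, f a = g a) : PrimrecRat g := (funext h : f = g) ▸ hf

theorem comp {e : β → α} (hf : PrimrecRat f) (he : Primrec e) : PrimrecRat fun b => f (e b) := by
  obtain ⟨h, hh, H⟩ := hf
  exact ⟨_, hh.comp he, fun b => H _⟩

theorem const (r : ℚ) : PrimrecRat fun _ : α => r := by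
  obtain ⟨m, hm⟩ := ratNum_surjective r
  exact ⟨fun _ => m, Primrec.const m, fun _ => hm⟩

theorem natCast {u : α → ℕ} (hu : Primrec u) : PrimrecRat fun a => (u a : ℚ) :=
  of_fraction hu (Primrec.const 0) (Primrec.const 0) (by simp)

theorem inv_natCast_succ {u : α → ℕ} (hu : Primrec u) : PrimrecRat fun a => ((u a : ℚ) + 1)⁻¹ :=
  of_fraction (Primrec.const 1) (Primrec.const 0) hu (by simp)

theorem ratNum_apply {u : α → ℕ} (hu : Primrec u) : PrimrecRat fun a => ratNum (u a) :=
  ⟨u, hu, fun _ => rfl⟩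

theorem nonnegRatNum_apply {u : α → ℕ} (hu : Primrec u) : PrimrecRat fun a => nonnegRatNum (u a) :=
  of_fraction (Primrec.fst.comp (Primrec.unpair.comp hu)) (Primrec.const 0)
    (Primrec.snd.comp (Primrec.unpair.comp hu)) (by simp [nonnegRatNum])

theorem ratVecNum_apply {n : ℕ} {u : α → ℕ} (hu : Primrec u) (i : Fin n) :
    PrimrecRat fun a => ratVecNum n (u a) i :=
  ratNum_apply <| (Primrec.list_getD 0).comp ((Primrec.ofNat (List ℕ)).comp hu) (Primrec.const _)

theorem add (hf : PrimrecRat f) (hg : PrimrecRat g) : PrimrecRat fun a => f a + g a := by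
  obtain ⟨u, v, w, hu, hv, hw, hf⟩ := hf.exists_fraction
  obtain ⟨u', v', w', hu', hv', hw', hg⟩ := hg.exists_fraction
  -- Denominators are stored minus one, and (w + 1)(w' + 1) - 1 = w w' + w + w'.
  refine of_fraction (u := fun a => u a * (w' a + 1) + u' a * (w a + 1))
    (v := fun a => v a * (w' a + 1) + v' a * (w a + 1)) (w := fun a => w a * w' a + w a + w' a)
    ?_ ?_ ?_ fun a => ?_
  · exact Primrec.nat_add.comp (Primrec.nat_mul.comp hu (Primrec.succ.comp hw'))
      (Primrec.nat_mul.comp hu' (Primrec.succ.comp hw))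
  · exact Primrec.nat_add.comp (Primrec.nat_mul.comp hv (Primrec.succ.comp hw'))
      (Primrec.nat_mul.comp hv' (Primrec.succ.comp hw))
  · exact Primrec.nat_add.comp (Primrec.nat_add.comp (Primrec.nat_mul.comp hw hw') hw) hw'
  · have h1 : (w a : ℚ) + 1 ≠ 0 := by positivity
    have h2 : (w' a : ℚ) + 1 ≠ 0 := by positivity
    have h3 : ((w a * w' a + w a + w' a : ℕ) : ℚ) + 1 = (w a + 1) * (w' a + 1) := by
      push_cast; ring
    rw [hf, hg, h3]
    field_simp
    push_cast
    ring

theorem mul (hf : PrimrecRat f) (hg : PrimrecRat g) : PrimrecRat fun a => f a * g a := by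
  obtain ⟨u, v, w, hu, hv, hw, hf⟩ := hf.exists_fraction
  obtain ⟨u', v', w', hu', hv', hw', hg⟩ := hg.exists_fraction
  refine of_fraction (u := fun a => u a * u' a + v a * v' a)
    (v := fun a => u a * v' a + v a * u' a) (w := fun a => w a * w' a + w a + w' a)
    ?_ ?_ ?_ fun a => ?_
  · exact Primrec.nat_add.comp (Primrec.nat_mul.comp hu hu') (Primrec.nat_mul.comp hv hv')
  · exact Primrec.nat_add.comp (Primrec.nat_mul.comp hu hv') (Primrec.nat_mul.comp hv hu')
  · exact Primrec.nat_add.comp (Primrec.nat_add.comp (Primrec.nat_mul.comp hw hw') hw) hw'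
  · have h1 : (w a : ℚ) + 1 ≠ 0 := by positivity
    have h2 : (w' a : ℚ) + 1 ≠ 0 := by positivity
    have h3 : ((w a * w' a + w a + w' a : ℕ) : ℚ) + 1 = (w a + 1) * (w' a + 1) := by
      push_cast; ring
    rw [hf, hg, h3]
    field_simp
    push_cast
    ring

theorem sub (hf : PrimrecRat f) (hg : PrimrecRat g) : PrimrecRat fun a => f a - g a :=
  (hf.add ((const (-1)).mul hg)).of_eq fun a => by ring

theorem sq (hf : PrimrecRat f) : PrimrecRat fun a => f a ^ 2 :=
  (hf.mul hf).of_eq fun a => (pow_two (f a)).symm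

theorem sum {ι : Type*} (s : Finset ι) {F : ι → α → ℚ} (hF : ∀ i, PrimrecRat (F i)) :
    PrimrecRat fun a => ∑ i ∈ s, F i a := by
  classical
  induction s using Finset.induction_on with
  | empty => simpa using const 0
  | insert i s hi ih => simpa [Finset.sum_insert hi] using (hF i).add ih

theorem lt (hf : PrimrecRat f) (hg : PrimrecRat g) : PrimrecPred fun a => f a < g a := by
  obtain ⟨u, v, w, hu, hv, hw, hf⟩ := hf.exists_fraction
  obtain ⟨u', v', w', hu', hv', hw', hg⟩ := hg.exists_fraction
  refine (Primrec.nat_lt.comp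
    (Primrec.nat_add.comp (Primrec.nat_mul.comp hu (Primrec.succ.comp hw'))
      (Primrec.nat_mul.comp hv' (Primrec.succ.comp hw)))
    (Primrec.nat_add.comp (Primrec.nat_mul.comp hu' (Primrec.succ.comp hw))
      (Primrec.nat_mul.comp hv (Primrec.succ.comp hw')))).of_eq fun a => ?_
  have h1 : (0 : ℚ) < (w a : ℚ) + 1 := by positivity
  have h2 : (0 : ℚ) < (w' a : ℚ) + 1 := by positivity
  rw [hf, hg, div_lt_div_iff₀ h1 h2, ← Nat.cast_lt (α := ℚ)]
  push_cast
  constructor <;> intro h <;> linarith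

theorem floor (hf : PrimrecRat f) : PrimrecRat fun a => (⌊f a⌋ : ℚ) := by
  obtain ⟨u, v, w, hu, hv, hw, hf⟩ := hf.exists_fraction
  -- Since (u - v)/(w + 1) = (u + v w)/(w + 1) - v, the floor reduces to division of natural
  -- numbers, with no negative numerator.
  refine of_fraction (u := fun a => (u a + v a * w a) / (w a + 1)) (v := v) (w := fun _ => 0)
    (Primrec.nat_div.comp (Primrec.nat_add.comp hu (Primrec.nat_mul.comp hv hw))
      (Primrec.succ.comp hw)) hv (Primrec.const 0) fun a => ?_
  have h1 : (w a : ℚ) + 1 ≠ 0 := by positivity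
  have h2 : f a = ((u a + v a * w a : ℕ) : ℚ) / ((w a + 1 : ℕ) : ℚ) - (v a : ℤ) := by
    rw [hf]; push_cast; field_simp; ring
  rw [h2, Int.floor_sub_intCast, Rat.floor_natCast_div_natCast]
  simp only [Int.cast_sub, ← Int.natCast_ediv, Int.cast_natCast, Nat.cast_zero, zero_add, div_one]

/-- The powers of two with exponents `intNum (u a)`. -/
theorem two_zpow {u : α → ℕ} (hu : Primrec u) : PrimrecRat fun a => (2 : ℚ) ^ intNum (u a) := by
  have hp : Primrec fun m : ℕ => 2 ^ m :=
    (Primrec₂.unpaired'.1 Nat.Primrec.pow).comp (Primrec.const 2) Primrec.id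
  have h := Primrec.unpair.comp hu
  refine of_fraction (u := fun a => 2 ^ (u a).unpair.1) (v := fun _ => 0)
    (w := fun a => 2 ^ (u a).unpair.2 - 1) (hp.comp (Primrec.fst.comp h)) (Primrec.const 0)
    (Primrec.pred.comp (hp.comp (Primrec.snd.comp h))) fun a => ?_
  have h1 : ((2 ^ (u a).unpair.2 - 1 : ℕ) : ℚ) + 1 = 2 ^ (u a).unpair.2 := by
    exact_mod_cast Nat.sub_add_cancel Nat.one_le_two_pow
  rw [h1, intNum, zpow_sub₀ two_ne_zero]
  simp

theorem two_zpow_neg {u : α → ℕ} (hu : Primrec u) :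
    PrimrecRat fun a => (2 : ℚ) ^ (-intNum (u a)) := by
  have h := Primrec.unpair.comp hu
  refine (two_zpow (Primrec₂.natPair.comp (Primrec.snd.comp h) (Primrec.fst.comp h))).of_eq
    fun a => ?_
  simp [intNum]

/-- A vector of primitive recursive rational-valued functions, as a function into codes. -/
theorem exists_vecCode {n : ℕ} {F : α → Fin n → ℚ} (hF : ∀ i, PrimrecRat fun a => F a i) :
    ∃ h : α → ℕ, Primrec h ∧ ∀ a, ratVecNum n (h a) = F a := by
  choose c hc e using hF
  refine ⟨fun a => Encodable.encode (List.ofFn fun i => c i a),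
    Primrec.encode.comp (Primrec.list_ofFn hc), fun a => funext fun i => ?_⟩
  simp [ratVecNum, Denumerable.ofNat_encode, e]

theorem exists_nonnegCode (hf : PrimrecRat f) (h0 : ∀ a, 0 ≤ f a) :
    ∃ h : α → ℕ, Primrec h ∧ ∀ a, nonnegRatNum (h a) = f a := by
  obtain ⟨u, v, w, hu, hv, hw, hf⟩ := hf.exists_fraction
  -- Truncated subtraction is exact here, because a nonnegative value forces v ≤ u.
  refine ⟨_, Primrec₂.natPair.comp (Primrec.nat_sub.comp hu hv) hw, fun a => ?_⟩
  have h1 : (0 : ℚ) < (w a : ℚ) + 1 := by positivity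
  have h2 : v a ≤ u a := by
    have h := h0 a
    rw [hf, le_div_iff₀ h1] at h
    exact_mod_cast (by linarith : (v a : ℚ) ≤ u a)
  simp [nonnegRatNum, hf, Nat.cast_sub h2]

end PrimrecRat

/-! ### Machines from computable functions on finite prefixes -/

/-- The prefix of length `t` of a sequence. -/
def Baire.take (s : Baire) (t : ℕ) : List ℕ := (List.range t).map s

theorem Baire.length_take (s : Baire) (t : ℕ) : (s.take t).length = t := by simp [Baire.take]

theorem Baire.take_succ (s : Baire) (t : ℕ) : s.take (t + 1) = s.take t ++ [s t] := by
  simp [Baire.take, List.range_succ]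

theorem Baire.getD_take {s : Baire} {t i : ℕ} (h : i < t) : (s.take t).getD i 0 = s i := by
  simp [Baire.take, List.getD, h]

/-- The partial function `f`, evaluated on longer and longer prefixes of `s`, determines `q`. -/
def Determines (f : List ℕ → ℕ → Option ℕ) (s q : Baire) : Prop :=
  ∀ m, (∀ t v, f (s.take t) m = some v → v = q m) ∧ ∃ T, ∀ t, T ≤ t → f (s.take t) m = some (q m)

/-- The machine that reads its input cell by cell, keeps in its work word the number of symbols
written so far followed by the part of the input read so far, and writes the next symbol as soon as
`f` provides it. -/
def prefixMachine (f : List ℕ → ℕ → Option ℕ) (hf : Computable₂ f) : Type2Machine where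
  start := [0]
  step w a :=
    (((w.headI + (f (w.tail ++ [a]) w.headI).toList.length) :: (w.tail ++ [a])),
      f (w.tail ++ [a]) w.headI, true)
  computable_step := by
    have hl : Computable fun x : List ℕ × ℕ => x.1.tail ++ [x.2] :=
      Computable.list_concat.comp (Primrec.list_tail.to_comp.comp Computable.fst) Computable.snd
    have hh : Computable fun x : List ℕ × ℕ => x.1.headI :=
      Primrec.list_headI.to_comp.comp Computable.fst
    have hv : Computable fun x : List ℕ × ℕ => f (x.1.tail ++ [x.2]) x.1.headI := hf.comp hl hh
    have hn : Computable fun x : List ℕ × ℕ => (f (x.1.tail ++ [x.2]) x.1.headI).toList.length :=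
      Computable.list_length.comp (Primrec.optionToList.to_comp.comp hv)
    exact (Computable.list_cons.comp (Primrec.nat_add.to_comp.comp hh hn) hl).pair
      (hv.pair (Computable.const true))

section prefixMachine

variable {f : List ℕ → ℕ → Option ℕ} (hf : Computable₂ f) (s q : Baire)

theorem prefixMachine_run_succ (t : ℕ) : (prefixMachine f hf).run s (t + 1) =
    (prefixMachine f hf).next s ((prefixMachine f hf).run s t) := by
  simp [Type2Machine.run, Function.iterate_succ_apply']

/-- The invariant of the run: every symbol that `f` provides is the correct one, so the output is
always a prefix of `q` and its length is the stored counter. -/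
theorem prefixMachine_run (h : Determines f s q) (t : ℕ) :
    ∃ m, (prefixMachine f hf).run s t = ⟨m :: s.take t, t, q.take m⟩ := by
  induction t with
  | zero => exact ⟨0, by simp [Type2Machine.run, prefixMachine, Baire.take]⟩
  | succ t ih =>
    obtain ⟨m, hm⟩ := ih
    rw [prefixMachine_run_succ, hm]
    cases hv : f (s.take (t + 1)) m with
    | none => exact ⟨m, by simp [Type2Machine.next, prefixMachine, ← Baire.take_succ, hv]⟩
    | some v =>
      refine ⟨m + 1, ?_⟩
      simp [Type2Machine.next, prefixMachine, ← Baire.take_succ, hv, (h m).1 _ _ hv]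

/-- The counter is monotone and unbounded: once the prefix is long enough, `f` answers at the
pending position, so the machine cannot stay there forever. -/
theorem prefixMachine_writes (h : Determines f s q) : (prefixMachine f hf).Writes s q := by
  choose c hc using prefixMachine_run hf s q h
  have hstep : ∀ t, c (t + 1) = c t + (f (s.take (t + 1)) (c t)).toList.length := by
    intro t
    have h1 := hc (t + 1)
    rw [prefixMachine_run_succ, hc t] at h1
    simp [Type2Machine.next, prefixMachine, ← Baire.take_succ] at h1
    exact h1.1.symm
  have hmono : Monotone c := monotone_nat_of_le_succ fun t => by rw [hstep]; omega
  have hunb : ∀ m, ∃ t, m ≤ c t := by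
    intro m
    induction m with
    | zero => exact ⟨0, Nat.zero_le _⟩
    | succ m ih =>
      obtain ⟨t, ht⟩ := ih
      obtain ⟨T, hT⟩ := (h m).2
      have h1 : m ≤ c (max t T) := ht.trans (hmono (le_max_left _ _))
      rcases h1.eq_or_lt with h2 | h2
      · refine ⟨max t T + 1, ?_⟩
        rw [hstep, ← h2, hT _ ((le_max_right _ _).trans (Nat.le_succ _))]
        simp
      · exact ⟨_, h2⟩
  intro m
  obtain ⟨t, ht⟩ := hunb (m + 1)
  refine ⟨t, ?_⟩
  rw [hc t]
  simp [Baire.take, show m < c t from ht]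

end prefixMachine

theorem Determines.unique {f : List ℕ → ℕ → Option ℕ} {s q q' : Baire} (h : Determines f s q)
    (h' : Determines f s q') : q = q' := funext fun m => by
  obtain ⟨T, hT⟩ := (h m).2
  exact (h' m).1 _ _ (hT T le_rfl)

/-- A problem is computable if some computable function on prefixes determines, from each name of
each of its instances, a name of a result. -/
theorem Problem.isComputable_of_determines {X Y : Type*} {δ : SpaceRepresentation X}
    {γ : SpaceRepresentation Y} {P : Problem X Y} (f : List ℕ → ℕ → Option ℕ) (hf : Computable₂ f)
    (h : ∀ s x, δ.IsName s x → x ∈ P.dom → ∃ q, Determines f s q ∧ ∃ y ∈ P x, γ.IsName q y) :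
    P.IsComputable δ γ := by
  -- The determined sequence is unique, so the choice in this realizer is harmless.
  refine ⟨fun s => ⟨∃ q, Determines f s q, Exists.choose⟩,
    ⟨prefixMachine f hf, fun s q hq => ?_⟩, fun s x hs hx => ?_⟩
  · obtain ⟨hd, rfl⟩ := hq
    exact prefixMachine_writes hf s _ hd.choose_spec
  · obtain ⟨q, hq, y, hy, hqy⟩ := h s x hs hx
    exact ⟨q, ⟨⟨q, hq⟩, Determines.unique (Exists.choose_spec (⟨q, hq⟩ : ∃ q, _)) hq⟩, y, hy, hqy⟩

/-! ### Dyadic cubes in Euclidean space -/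

section Cubes

variable {n : ℕ}

/-- The center of `dyadicCube k a` as a point of Euclidean space. -/
noncomputable def cubeCenter (k : ℤ) (a : Fin n → ℤ) : EuclideanSpace ℝ (Fin n) :=
  ratPoint (dyadicCenter k a)

theorem cubeCenter_apply (k : ℤ) (a : Fin n → ℤ) (i : Fin n) :
    cubeCenter k a i = ((a i : ℝ) + 1 / 2) * 2 ^ (-k) := by
  simp [cubeCenter, ratPoint, dyadicCenter]

/-- A point whose coordinates differ from those of another one by at most `r`. -/
theorem dist_le_sqrt_mul {x y : EuclideanSpace ℝ (Fin n)} {r : ℝ} (hr : 0 ≤ r)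
    (h : ∀ i, |x i - y i| ≤ r) : dist x y ≤ √n * r := by
  rw [EuclideanSpace.dist_eq]
  refine Real.sqrt_le_iff.2 ⟨by positivity, ?_⟩
  rw [mul_pow, Real.sq_sqrt (Nat.cast_nonneg n)]
  calc ∑ i, dist (x i) (y i) ^ 2 ≤ ∑ _i : Fin n, r ^ 2 :=
        Finset.sum_le_sum fun i _ => pow_le_pow_left₀ dist_nonneg (h i) 2
    _ = n * r ^ 2 := by simp

theorem dist_eq_sqrt_mul {x y : EuclideanSpace ℝ (Fin n)} {r : ℝ} (hr : 0 ≤ r)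
    (h : ∀ i, |x i - y i| = r) : dist x y = √n * r := by
  rw [EuclideanSpace.dist_eq]
  simp only [Real.dist_eq, h]
  simp [Real.sqrt_mul, Real.sqrt_sq hr]

theorem cubeCenter_mem (k : ℤ) (a : Fin n → ℤ) : cubeCenter k a ∈ dyadicCube k a := fun i => by
  have := zpow_pos (two_pos : (0 : ℝ) < 2) (-k)
  rw [cubeCenter_apply]
  constructor <;> nlinarith

theorem two_zpow_neg_pred (k : ℤ) : (2 : ℝ) ^ (-(k - 1)) = 2 * 2 ^ (-k) := by
  rw [show -(k - 1) = 1 + -k by ring, zpow_add₀ two_ne_zero, zpow_one]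

theorem parent_cast (z : ℤ) : ((z / 2 : ℤ) : ℝ) = z / 2 ∨ ((z / 2 : ℤ) : ℝ) = (z - 1) / 2 := by
  rcases Int.emod_two_eq_zero_or_one z with h | h
  · left
    have h1 : z = 2 * (z / 2) := by omega
    have h2 : (z : ℝ) = 2 * ((z / 2 : ℤ) : ℝ) := by exact_mod_cast h1
    linarith
  · right
    have h1 : z = 2 * (z / 2) + 1 := by omega
    have h2 : (z : ℝ) = 2 * ((z / 2 : ℤ) : ℝ) + 1 := by exact_mod_cast h1
    linarith

/-- The center of the parent of a dyadic cube is a corner of the cube. -/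
theorem parentCenter_mem (k : ℤ) (a : Fin n → ℤ) :
    cubeCenter (k - 1) (fun i => a i / 2) ∈ dyadicCube k a := fun i => by
  have := zpow_pos (two_pos : (0 : ℝ) < 2) (-k)
  rw [cubeCenter_apply, two_zpow_neg_pred]
  rcases parent_cast (a i) with h | h <;> rw [h] <;> constructor <;> nlinarith

/-- In each coordinate the two centers differ by exactly half the side of the smaller cube,
whichever half of the parent it occupies. -/
theorem dist_parentCenter (k : ℤ) (a : Fin n → ℤ) :
    dist (cubeCenter k a) (cubeCenter (k - 1) fun i => a i / 2) = √n * (2 ^ (-k) / 2) := by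
  have h0 := zpow_pos (two_pos : (0 : ℝ) < 2) (-k)
  refine dist_eq_sqrt_mul (by positivity) fun i => ?_
  rw [cubeCenter_apply, cubeCenter_apply, two_zpow_neg_pred]
  rcases parent_cast (a i) with h | h <;> rw [h]
  · rw [← abs_neg, abs_of_nonneg] <;> ring_nf
    positivity
  · rw [abs_of_nonneg] <;> ring_nf
    positivity

theorem dist_cubeCenter_le {k : ℤ} {a : Fin n → ℤ} {x : EuclideanSpace ℝ (Fin n)}
    (hx : x ∈ dyadicCube k a) : dist x (cubeCenter k a) ≤ √n * (2 ^ (-k) / 2) := by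
  have h0 := zpow_pos (two_pos : (0 : ℝ) < 2) (-k)
  refine dist_le_sqrt_mul (by positivity) fun i => ?_
  rw [cubeCenter_apply, abs_le]
  constructor <;> nlinarith [hx i]

theorem dist_le_of_mem_dyadicCube {k : ℤ} {a : Fin n → ℤ} {x y : EuclideanSpace ℝ (Fin n)}
    (hx : x ∈ dyadicCube k a) (hy : y ∈ dyadicCube k a) : dist x y ≤ √n * 2 ^ (-k) := by
  have h0 := zpow_pos (two_pos : (0 : ℝ) < 2) (-k)
  refine dist_le_sqrt_mul h0.le fun i => ?_
  rw [abs_le]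
  constructor <;> nlinarith [hx i, hy i]

theorem diam_dyadicCube (k : ℤ) (a : Fin n → ℤ) :
    Metric.diam (dyadicCube k a) = √n * 2 ^ (-k) := by
  have h0 := zpow_pos (two_pos : (0 : ℝ) < 2) (-k)
  refine le_antisymm (Metric.diam_le_of_forall_dist_le (by positivity)
    fun x hx y hy => dist_le_of_mem_dyadicCube hx hy) ?_
  have hb : Bornology.IsBounded (dyadicCube k a) :=
    Metric.isBounded_iff.2 ⟨_, fun x hx y hy => dist_le_of_mem_dyadicCube hx hy⟩
  set x : EuclideanSpace ℝ (Fin n) := WithLp.toLp 2 fun i => ((a i : ℝ) + 1) * 2 ^ (-k) with hx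
  set y : EuclideanSpace ℝ (Fin n) := WithLp.toLp 2 fun i => (a i : ℝ) * 2 ^ (-k) with hy
  have hxm : x ∈ dyadicCube k a := fun i => by
    simp only [hx]; constructor <;> nlinarith
  have hym : y ∈ dyadicCube k a := fun i => by
    simp only [hy]; constructor <;> nlinarith
  rw [← dist_eq_sqrt_mul (x := x) (y := y) h0.le]
  · exact Metric.dist_le_diam_of_mem hb hxm hym
  · intro i
    simp only [hx, hy]
    rw [abs_of_nonneg] <;> ring_nf
    positivity

/-- The index of the dyadic cube of side `2⁻ᵏ` that contains the point `x`. -/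
noncomputable def cubeIndex (x : EuclideanSpace ℝ (Fin n)) (k : ℤ) : Fin n → ℤ :=
  fun i => ⌊x i * 2 ^ k⌋

theorem zpow_mul_zpow_neg (k : ℤ) : (2 : ℝ) ^ k * 2 ^ (-k) = 1 := by
  rw [← zpow_add₀ two_ne_zero]; simp

theorem mem_dyadicCube_cubeIndex (x : EuclideanSpace ℝ (Fin n)) (k : ℤ) :
    x ∈ dyadicCube k (cubeIndex x k) := fun i => by
  have h0 := zpow_pos (two_pos : (0 : ℝ) < 2) (-k)
  have h1 : x i = x i * 2 ^ k * 2 ^ (-k) := by rw [mul_assoc, zpow_mul_zpow_neg, mul_one]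
  have h2 := Int.floor_le (x i * 2 ^ k)
  have h3 := (Int.lt_floor_add_one (x i * 2 ^ k)).le
  constructor
  · conv_rhs => rw [h1]
    exact mul_le_mul_of_nonneg_right h2 h0.le
  · conv_lhs => rw [h1]
    exact mul_le_mul_of_nonneg_right h3 h0.le

/-- Flooring commutes with halving, so the cubes selected around a fixed point form a chain under
the parent relation. -/
theorem cubeIndex_pred (x : EuclideanSpace ℝ (Fin n)) (k : ℤ) :
    cubeIndex x (k - 1) = fun i => cubeIndex x k i / 2 := funext fun i => by
  have h : x i * 2 ^ (k - 1) = x i * 2 ^ k / ((2 : ℕ) : ℝ) := by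
    rw [zpow_sub_one₀ two_ne_zero]; push_cast; ring
  simp only [cubeIndex]
  rw [h, Int.floor_div_natCast]
  rfl

/-- The floor picks the half-open cube containing the point, and an interior point avoids the upper
faces. Cubes whose interiors share a point thus lie on one chain. -/
theorem cubeIndex_eq_of_mem_interior {k : ℤ} {a : Fin n → ℤ} {x : EuclideanSpace ℝ (Fin n)}
    (hx : x ∈ interior (dyadicCube k a)) : cubeIndex x k = a := funext fun i => by
  have h0 := zpow_pos (two_pos : (0 : ℝ) < 2) k
  have hm := interior_subset hx
  have hlt : x i < ((a i : ℝ) + 1) * 2 ^ (-k) := by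
    obtain ⟨ε, hε, hb⟩ := Metric.isOpen_iff.1 isOpen_interior x hx
    -- Moving slightly in direction i stays in the cube, which makes the upper bound on the
    -- coordinate strict.
    have hy : x + EuclideanSpace.single i (ε / 2) ∈ dyadicCube k a := by
      refine interior_subset (hb ?_)
      simp [abs_of_pos hε, hε]
    have := (hy i).2
    simp at this
    have h2 := zpow_neg (2 : ℝ) k
    rw [h2]
    linarith
  rw [cubeIndex, Int.floor_eq_iff]
  have h1 : (2 : ℝ) ^ (-k) * 2 ^ k = 1 := by rw [mul_comm, zpow_mul_zpow_neg]
  constructor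
  · calc (a i : ℝ) = a i * 2 ^ (-k) * 2 ^ k := by rw [mul_assoc, h1, mul_one]
      _ ≤ x i * 2 ^ k := mul_le_mul_of_nonneg_right (hm i).1 h0.le
  · calc x i * 2 ^ k < ((a i : ℝ) + 1) * 2 ^ (-k) * 2 ^ k := mul_lt_mul_of_pos_right hlt h0
      _ = a i + 1 := by rw [mul_assoc, h1, mul_one]

theorem le_setDist {A B : Set (EuclideanSpace ℝ (Fin n))} (hA : A.Nonempty) (hB : B.Nonempty)
    {r : ℝ} (h : ∀ x ∈ A, ∀ y ∈ B, r ≤ dist x y) : r ≤ setDist A B :=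
  le_csInf (hA.image2 hB) (by rintro _ ⟨x, hx, y, hy, rfl⟩; exact h x hx y hy)

theorem setDist_le {A B : Set (EuclideanSpace ℝ (Fin n))} {x y : EuclideanSpace ℝ (Fin n)}
    (hx : x ∈ A) (hy : y ∈ B) : setDist A B ≤ dist x y :=
  csInf_le ⟨0, by rintro _ ⟨x, -, y, -, rfl⟩; exact dist_nonneg⟩ ⟨x, hx, y, hy, rfl⟩

/-! ### The decomposition obtained from approximate distance tests -/

/-- `τ k a` is the outcome of an approximate test whether the center of `dyadicCube k a` is far from
`F`: positive outcomes are correct up to the factor `3 / 2` (times the diameter), negative ones up to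
the factor `5 / 2`. -/
structure IsDistanceTest (F : Set (EuclideanSpace ℝ (Fin n))) (τ : ℤ → (Fin n → ℤ) → Prop) :
    Prop where
  far : ∀ {k a}, τ k a → 3 / 2 * (√n * 2 ^ (-k)) < Metric.infDist (cubeCenter k a) F
  near : ∀ {k a}, ¬ τ k a → Metric.infDist (cubeCenter k a) F < 5 / 2 * (√n * 2 ^ (-k))

/-- The cubes with a positive test whose parents have a negative test. -/
def maximalCubes (τ : ℤ → (Fin n → ℤ) → Prop) : Set (DyadicCubes n) :=
  {Q | ∃ (k : ℤ) (a : Fin n → ℤ), (Q : Set (EuclideanSpace ℝ (Fin n))) = dyadicCube k a ∧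
    τ k a ∧ ¬ τ (k - 1) fun i => a i / 2}

namespace IsDistanceTest

variable {F : Set (EuclideanSpace ℝ (Fin n))} {τ : ℤ → (Fin n → ℤ) → Prop}

/-- Were the cube near, its parent's center would be at distance less than 5D/2 + D/2 = 3D from F, D
being the diameter of the cube. A far parent demands more than (3/2)(2D) = 3D. -/
theorem of_parent (h : IsDistanceTest F τ) {k : ℤ} {a : Fin n → ℤ}
    (hp : τ (k - 1) fun i => a i / 2) : τ k a := by
  by_contra hk
  have h1 := h.far hp
  have h2 := h.near hk
  have h3 := Metric.infDist_le_infDist_add_dist (s := F)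
    (x := cubeCenter (k - 1) fun i => a i / 2) (y := cubeCenter k a)
  rw [dist_comm, dist_parentCenter] at h3
  rw [two_zpow_neg_pred] at h1
  nlinarith

theorem mono (h : IsDistanceTest F τ) (x : EuclideanSpace ℝ (Fin n)) {k l : ℤ} (hkl : k ≤ l)
    (hk : τ k (cubeIndex x k)) : τ l (cubeIndex x l) := by
  induction l, hkl using Int.leInduction with
  | base => exact hk
  | succ l _ ih =>
    refine h.of_parent ?_
    rw [← cubeIndex_pred]
    simpa using ih

theorem le_dist (h : IsDistanceTest F τ) {k : ℤ} {a : Fin n → ℤ} (hk : τ k a)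
    {x y : EuclideanSpace ℝ (Fin n)} (hx : x ∈ dyadicCube k a) (hy : y ∈ F) :
    √n * 2 ^ (-k) ≤ dist x y := by
  have h1 := h.far hk
  have h2 := Metric.infDist_le_dist_of_mem (x := cubeCenter k a) hy
  have h3 := dist_triangle_left (cubeCenter k a) y x
  have h4 := dist_cubeCenter_le hx
  linarith

theorem exists_maximal (h : IsDistanceTest F τ) (hn : 0 < n) (hF : IsClosed F) (hne : F.Nonempty)
    {x : EuclideanSpace ℝ (Fin n)} (hx : x ∉ F) :
    ∃ k, τ k (cubeIndex x k) ∧ ¬ τ (k - 1) (cubeIndex x (k - 1)) := by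
  have hd : 0 < Metric.infDist x F := (hF.notMem_iff_infDist_pos hne).1 hx
  have hs : 0 < √(n : ℝ) := Real.sqrt_pos.2 (by exact_mod_cast hn)
  have hc : ∀ k, dist x (cubeCenter k (cubeIndex x k)) ≤ √n * (2 ^ (-k) / 2) := fun k =>
    dist_cubeCenter_le (mem_dyadicCube_cubeIndex x k)
  have hsmall : ∃ k, τ k (cubeIndex x k) := by
    -- A near cube of diameter D containing x gives d(x, F) < 5D/2 + D/2 = 3D, hence the factor 3.
    obtain ⟨m, hm⟩ := exists_pow_lt_of_lt_one (div_pos hd (mul_pos three_pos hs))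
      (one_half_lt_one (α := ℝ))
    refine ⟨m, by_contra fun hk => ?_⟩
    have h1 := h.near hk
    have h2 := hc m
    have h3 := Metric.infDist_le_infDist_add_dist (s := F) (x := x)
      (y := cubeCenter (m : ℤ) (cubeIndex x m))
    rw [lt_div_iff₀ (by positivity)] at hm
    have h4 : (2 : ℝ) ^ (-(m : ℤ)) = (1 / 2) ^ m := by simp
    rw [h4] at h1 h2
    nlinarith
  -- A far cube of diameter D containing x gives d(x, F) > 3D/2 - D/2 = D, which fails once D
  -- exceeds d(x, F).
  obtain ⟨N, hN⟩ := pow_unbounded_of_one_lt (Metric.infDist x F / √n) (one_lt_two (α := ℝ))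
  have hlarge : ¬ τ (-(N : ℤ)) (cubeIndex x (-(N : ℤ))) := fun hk => by
    have h1 := h.far hk
    have h2 := hc (-(N : ℤ))
    have h3 := Metric.infDist_le_infDist_add_dist (s := F) (y := x)
      (x := cubeCenter (-(N : ℤ)) (cubeIndex x (-(N : ℤ))))
    rw [div_lt_iff₀ hs] at hN
    rw [dist_comm] at h3
    simp only [neg_neg, zpow_natCast] at h1 h2
    nlinarith
  obtain ⟨k, hk, hmin⟩ := Int.exists_least_of_bdd (P := fun k => τ k (cubeIndex x k))
    ⟨-(N : ℤ), fun z hz => not_lt.1 fun hlt => hlarge (h.mono x hlt.le hz)⟩ hsmall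
  exact ⟨k, hk, fun hk' => absurd (hmin _ hk') (by omega)⟩

/-- Both cubes lie on the chain of x. If the first were strictly larger, its farness would pass down
to the parent of the second. Applied in both directions, this makes the levels of two selected cubes
equal. -/
theorem le_of_interior_inter (h : IsDistanceTest F τ) {k k' : ℤ} {a a' : Fin n → ℤ}
    (hk : τ k a) (hk' : ¬ τ (k' - 1) fun i => a' i / 2) {x : EuclideanSpace ℝ (Fin n)}
    (hx : x ∈ interior (dyadicCube k a)) (hx' : x ∈ interior (dyadicCube k' a')) : k' ≤ k := by
  obtain rfl := cubeIndex_eq_of_mem_interior hx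
  obtain rfl := cubeIndex_eq_of_mem_interior hx'
  by_contra hlt
  rw [← cubeIndex_pred] at hk'
  exact hk' (h.mono x (by omega) hk)

end IsDistanceTest

theorem maximalCubes_mem_CUBE {F : TopologicalSpace.Closeds (EuclideanSpace ℝ (Fin n))}
    {τ : ℤ → (Fin n → ℤ) → Prop} (h : IsDistanceTest (F : Set (EuclideanSpace ℝ (Fin n))) τ)
    (hn : 0 < n) (hne : (F : Set (EuclideanSpace ℝ (Fin n))).Nonempty) :
    maximalCubes τ ∈ CUBE n F := by
  have hs : 0 < √(n : ℝ) := Real.sqrt_pos.2 (by exact_mod_cast hn)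
  refine ⟨hne, Set.Subset.antisymm ?_ ?_, ?_, ?_⟩
  · intro x hx hxF
    simp only [Set.mem_iUnion] at hx
    obtain ⟨Q, ⟨k, a, hQ, hk, -⟩, hxQ⟩ := hx
    rw [hQ] at hxQ
    have h1 := h.le_dist hk hxQ hxF
    have h2 : 0 < √(n : ℝ) * 2 ^ (-k) := by positivity
    rw [dist_self] at h1
    linarith
  · intro x hx
    obtain ⟨k, hk, hk'⟩ := h.exists_maximal hn F.isClosed hne hx
    rw [cubeIndex_pred] at hk'
    simp only [Set.mem_iUnion]
    exact ⟨⟨_, k, cubeIndex x k, rfl⟩, ⟨k, _, rfl, hk, hk'⟩, mem_dyadicCube_cubeIndex x k⟩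
  · rintro Q ⟨k, a, hQ, hk, hp⟩ Q' ⟨k', a', hQ', hk', hp'⟩ hne
    rw [Set.eq_empty_iff_forall_notMem]
    rintro x ⟨hx, hx'⟩
    rw [hQ] at hx
    rw [hQ'] at hx'
    obtain rfl := le_antisymm (h.le_of_interior_inter hk' hp hx' hx)
      (h.le_of_interior_inter hk hp' hx hx')
    refine hne (Subtype.ext ?_)
    rw [hQ, hQ', ← cubeIndex_eq_of_mem_interior hx, ← cubeIndex_eq_of_mem_interior hx']
  · rintro Q ⟨k, a, hQ, hk, hp⟩
    have h0 : 0 < √(n : ℝ) * 2 ^ (-k) := by positivity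
    rw [hQ, diam_dyadicCube]
    constructor
    · have := le_setDist ⟨_, cubeCenter_mem k a⟩ hne fun x hx y hy => h.le_dist hk hx hy
      linarith
    · obtain ⟨y, hy, hlt⟩ := (Metric.infDist_lt_iff hne).1 (h.near hp)
      have h1 := setDist_le (parentCenter_mem k a) hy
      rw [two_zpow_neg_pred] at hlt
      linarith

theorem dom_CUBE_of_exists (h : ∀ F : TopologicalSpace.Closeds (EuclideanSpace ℝ (Fin n)),
    (F : Set (EuclideanSpace ℝ (Fin n))).Nonempty → (CUBE n F).Nonempty) :
    Problem.dom (CUBE n) = {F : TopologicalSpace.Closeds (EuclideanSpace ℝ (Fin n)) |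
      (F : Set (EuclideanSpace ℝ (Fin n))).Nonempty} :=
  Set.Subset.antisymm (fun _ ⟨_, hF, _⟩ => hF) h

theorem empty_mem_CUBE_zero {F : TopologicalSpace.Closeds (EuclideanSpace ℝ (Fin 0))}
    (hne : (F : Set (EuclideanSpace ℝ (Fin 0))).Nonempty) : ∅ ∈ CUBE 0 F := by
  refine ⟨hne, ?_, by simp, by simp⟩
  have : (F : Set (EuclideanSpace ℝ (Fin 0))) = Set.univ := Subsingleton.eq_univ_of_nonempty hne
  simp [this]

end Cubes

/-! ### Finite certificates for the distance from a closed set -/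

/-- The square of the Euclidean distance of two rational vectors. -/
def ratDistSq {n : ℕ} (x y : Fin n → ℚ) : ℚ := ∑ i, (x i - y i) ^ 2

/-- The points of the grid with `(t + 1) ^ n` points in the cube with center `c` and side `2 * W`. -/
def gridPoint (n t : ℕ) (c : Fin n → ℚ) (W : ℚ) (j : ℕ) : Fin n → ℚ := fun i =>
  c i - W + 2 * W * ((t : ℚ) + 1)⁻¹ * ((j / (t + 1) ^ (i : ℕ) % (t + 1) : ℕ) : ℚ)

/-- A bound for the distance from a point of the cube to the grid. -/
def gridMesh (n t : ℕ) (W : ℚ) : ℚ := n * (2 * W * ((t : ℚ) + 1)⁻¹)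

/-- Every grid point that is close to the ball with center `c` and radius `R` lies deep inside one of
the balls with the numbers `p 0, …, p (t - 1)`. -/
def IsFarCertificate (n : ℕ) (p : Baire) (t : ℕ) (c : Fin n → ℚ) (R W : ℚ) : Prop :=
  ∀ j < (t + 1) ^ n, (R + gridMesh n t W) ^ 2 < ratDistSq (gridPoint n t c W j) c ∨
    ∃ i < t, gridMesh n t W < nonnegRatNum (p i).unpair.2 ∧
      ratDistSq (gridPoint n t c W j) (ratVecNum n (p i).unpair.1) <
        (nonnegRatNum (p i).unpair.2 - gridMesh n t W) ^ 2

section Certificates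

variable {n : ℕ}

theorem dist_ratPoint_sq (x y : Fin n → ℚ) :
    dist (ratPoint x) (ratPoint y) ^ 2 = (ratDistSq x y : ℝ) := by
  rw [EuclideanSpace.dist_eq, Real.sq_sqrt (Finset.sum_nonneg fun i _ => sq_nonneg _)]
  simp [ratDistSq, ratPoint, Real.dist_eq, sq_abs]

theorem ratDistSq_lt_sq_iff {x y : Fin n → ℚ} {r : ℚ} (hr : 0 ≤ r) :
    ratDistSq x y < r ^ 2 ↔ dist (ratPoint x) (ratPoint y) < r := by
  rw [← pow_lt_pow_iff_left₀ dist_nonneg (by exact_mod_cast hr) two_ne_zero, dist_ratPoint_sq]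
  exact_mod_cast Iff.rfl

theorem sq_lt_ratDistSq_iff {x y : Fin n → ℚ} {r : ℚ} (hr : 0 ≤ r) :
    r ^ 2 < ratDistSq x y ↔ (r : ℝ) < dist (ratPoint x) (ratPoint y) := by
  rw [← pow_lt_pow_iff_left₀ (by exact_mod_cast hr) dist_nonneg two_ne_zero, dist_ratPoint_sq]
  exact_mod_cast Iff.rfl

theorem abs_coord_sub_le_dist (x y : EuclideanSpace ℝ (Fin n)) (i : Fin n) :
    |x i - y i| ≤ dist x y := by
  have := PiLp.norm_apply_le (x - y) i
  rwa [dist_eq_norm]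

theorem exists_grid_coordinate (t : ℕ) {W u : ℝ} (hW : 0 < W) (hu : |u| ≤ W) :
    ∃ d < t + 1, |u - (-W + 2 * W * ((t : ℝ) + 1)⁻¹ * (d : ℕ))| ≤ 2 * W * ((t : ℝ) + 1)⁻¹ := by
  obtain ⟨h1, h2⟩ := abs_le.1 hu
  have ht : (0 : ℝ) < (t : ℝ) + 1 := by positivity
  set h : ℝ := 2 * W * ((t : ℝ) + 1)⁻¹ with hh
  have hpos : 0 < h := by positivity
  have hth : h * (t + 1) = 2 * W := by rw [hh]; field_simp
  have h3 : 0 ≤ (u + W) / h := div_nonneg (by linarith) hpos.le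
  have h4 := Nat.floor_le h3
  have h5 := Nat.lt_floor_add_one ((u + W) / h)
  rw [le_div_iff₀ hpos] at h4
  rw [div_lt_iff₀ hpos] at h5
  rcases le_or_gt ⌊(u + W) / h⌋₊ t with h6 | h6
  · refine ⟨_, Nat.lt_succ_of_le h6, ?_⟩
    rw [abs_le]
    constructor <;> nlinarith
  -- The grid omits the right endpoint of the interval; the last grid coordinate is one step away
  -- from it.
  · refine ⟨t, Nat.lt_succ_self t, ?_⟩
    have h7 : (t : ℝ) + 1 ≤ ⌊(u + W) / h⌋₊ := by exact_mod_cast h6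
    rw [abs_le]
    constructor <;> nlinarith

theorem exists_gridPoint (t : ℕ) {c : Fin n → ℚ} {W : ℚ} (hW : 0 < W)
    {y : EuclideanSpace ℝ (Fin n)} (hy : dist y (ratPoint c) ≤ W) :
    ∃ j < (t + 1) ^ n, dist y (ratPoint (gridPoint n t c W j)) ≤ gridMesh n t W := by
  have hW' : (0 : ℝ) < W := by exact_mod_cast hW
  have h1 : ∀ i : Fin n, |y i - c i| ≤ W := fun i =>
    (abs_coord_sub_le_dist y (ratPoint c) i).trans hy
  choose d hd hd' using fun i => exists_grid_coordinate t hW' (h1 i)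
  -- The number of a grid point has its coordinates as digits in base t + 1.
  refine ⟨finFunctionFinEquiv fun i => ⟨d i, hd i⟩, Fin.is_lt _, ?_⟩
  have h2 : (0 : ℝ) ≤ 2 * W * ((t : ℝ) + 1)⁻¹ := by positivity
  refine (dist_le_sqrt_mul h2 fun i => ?_).trans ?_
  · have h3 : (finFunctionFinEquiv (fun i => (⟨d i, hd i⟩ : Fin (t + 1))) : ℕ) / (t + 1) ^ (i : ℕ) %
        (t + 1) = d i :=
      congrArg Fin.val (congrFun (finFunctionFinEquiv.symm_apply_apply
        fun i => (⟨d i, hd i⟩ : Fin (t + 1))) i)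
    have h4 := hd' i
    simp only [ratPoint, gridPoint, h3]
    push_cast
    rwa [show y i - ((c i : ℝ) - W + 2 * W * ((t : ℝ) + 1)⁻¹ * (d i)) =
      y i - c i - (-W + 2 * W * ((t : ℝ) + 1)⁻¹ * (d i)) by ring]
  · rw [gridMesh]
    push_cast
    refine mul_le_mul_of_nonneg_right ?_ h2
    -- The mesh uses n in place of √n in order to stay rational.
    rw [Real.sqrt_le_left (Nat.cast_nonneg n)]
    exact_mod_cast Nat.le_self_pow two_ne_zero n

theorem gridMesh_nonneg (t : ℕ) {W : ℚ} (hW : 0 ≤ W) : 0 ≤ gridMesh n t W :=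
  mul_nonneg (Nat.cast_nonneg n) (mul_nonneg (mul_nonneg two_pos.le hW) (by positivity))

theorem exists_gridMesh_lt {ε : ℚ} (W : ℚ) (hε : 0 < ε) (N : ℕ) :
    ∃ t, N ≤ t ∧ gridMesh n t W < ε := by
  obtain ⟨m, hm⟩ := exists_nat_gt (n * (2 * W) / ε)
  refine ⟨max m N, le_max_right _ _, ?_⟩
  have h1 : (m : ℚ) ≤ (max m N : ℕ) := by exact_mod_cast le_max_left m N
  have h2 : (0 : ℚ) < ((max m N : ℕ) : ℚ) + 1 := by positivity
  rw [div_lt_iff₀ hε] at hm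
  rw [gridMesh, ← mul_assoc, ← div_eq_mul_inv, div_lt_iff₀ h2]
  nlinarith

/-- A point of F closer than R to c would be within the mesh of some grid point. That grid point is
then within R + mesh of c, so it lies deeper than the mesh inside a listed ball, and this ball
contains the point of F. -/
theorem IsFarCertificate.le_infDist {p : Baire} {t : ℕ} {c : Fin n → ℚ} {R W : ℚ}
    (h : IsFarCertificate n p t c R W) (hR : 0 < R) (hRW : R ≤ W)
    {F : Set (EuclideanSpace ℝ (Fin n))} (hne : F.Nonempty)
    (hF : F = (⋃ i ∈ Set.range p, ratBall n i)ᶜ) : (R : ℝ) ≤ Metric.infDist (ratPoint c) F := by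
  rw [Metric.le_infDist hne]
  intro y hy
  by_contra! hlt
  have hW : 0 < W := hR.trans_le hRW
  have hm := gridMesh_nonneg (n := n) t hW.le
  have hRW' : (R : ℝ) ≤ W := by exact_mod_cast hRW
  rw [dist_comm] at hlt
  obtain ⟨j, hj, hyj⟩ := exists_gridPoint t hW (hlt.le.trans hRW')
  rcases h j hj with h1 | ⟨i, -, h1, h2⟩
  · rw [sq_lt_ratDistSq_iff (by linarith)] at h1
    push_cast at h1
    have := dist_triangle_left (ratPoint (gridPoint n t c W j)) (ratPoint c) y
    linarith
  · rw [ratDistSq_lt_sq_iff (by linarith)] at h2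
    push_cast at h2
    rw [hF] at hy
    refine hy ?_
    simp only [Set.mem_iUnion, Set.mem_range, exists_prop]
    refine ⟨p i, ⟨i, rfl⟩, ?_⟩
    rw [ratBall, Metric.mem_ball]
    have := dist_triangle y (ratPoint (gridPoint n t c W j))
      (ratPoint (ratVecNum n (p i).unpair.1))
    linarith

/-- The closed ball of radius (R + W)/2 is compact and avoids F, so finitely many listed balls, all
shrunk by a common amount, already cover it. A grid finer than that amount then certifies. -/
theorem exists_isFarCertificate {p : Baire} {c : Fin n → ℚ} {R W : ℚ} (hR : 0 < R) (hRW : R < W)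
    {F : Set (EuclideanSpace ℝ (Fin n))} (hF : F = (⋃ i ∈ Set.range p, ratBall n i)ᶜ)
    (h : Metric.ball (ratPoint c) W ∩ F = ∅) : ∃ t, IsFarCertificate n p t c R W := by
  have hW : 0 < W := hR.trans hRW
  have hRW' : (R : ℝ) < W := by exact_mod_cast hRW
  let K := Metric.closedBall (ratPoint c) (((R + W) / 2 : ℚ) : ℝ)
  -- As N grows, more balls enter and the shrinking decreases, so these open sets increase and
  -- compactness yields a single N.
  let U : ℕ → Set (EuclideanSpace ℝ (Fin n)) := fun N => ⋃ i ∈ Finset.range N,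
    Metric.ball (ratPoint (ratVecNum n (p i).unpair.1))
      ((nonnegRatNum (p i).unpair.2 : ℝ) - 1 / ((N : ℝ) + 1))
  have hU : Monotone U := by
    intro N N' hN
    refine Set.iUnion₂_subset fun i hi => ?_
    refine Set.Subset.trans (Metric.ball_subset_ball ?_) (Set.subset_biUnion_of_mem (u := fun i =>
      Metric.ball (ratPoint (ratVecNum n (p i).unpair.1))
      ((nonnegRatNum (p i).unpair.2 : ℝ) - 1 / ((N' : ℝ) + 1)))
      (Finset.mem_coe.2 (Finset.range_mono hN hi)))
    have := Nat.one_div_le_one_div (α := ℝ) hN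
    linarith
  have hK : K ⊆ ⋃ N, U N := by
    intro x hx
    have hxF : x ∉ F := fun hxF => by
      have h1 : x ∈ Metric.ball (ratPoint c) (W : ℝ) ∩ F := by
        refine ⟨?_, hxF⟩
        have h2 : dist x (ratPoint c) ≤ (((R + W) / 2 : ℚ) : ℝ) := hx
        push_cast at h2
        rw [Metric.mem_ball]
        linarith
      rw [h] at h1
      exact h1
    rw [hF, Set.notMem_compl_iff] at hxF
    simp only [Set.mem_iUnion, Set.mem_range, exists_prop] at hxF
    obtain ⟨_, ⟨i, rfl⟩, hxi⟩ := hxF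
    rw [ratBall, Metric.mem_ball] at hxi
    obtain ⟨N, hN⟩ := exists_nat_one_div_lt (sub_pos.2 hxi)
    have h1 := Nat.one_div_le_one_div (α := ℝ) (le_max_left N (i + 1))
    simp only [U, Set.mem_iUnion]
    refine ⟨max N (i + 1), i, Finset.mem_range.2 (Nat.lt_of_succ_le (le_max_right _ _)), ?_⟩
    rw [Metric.mem_ball]
    linarith
  obtain ⟨N, hN⟩ := (isCompact_closedBall _ _).elim_directed_cover U
    (fun N => isOpen_biUnion fun i _ => Metric.isOpen_ball) hK hU.directed_le
  -- The first bound makes the shrinking exceed the mesh; the second puts the grid points within R +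
  -- mesh of c into the compact ball.
  have hε : (0 : ℚ) < min (1 / ((N : ℚ) + 1)) ((W - R) / 2) :=
    lt_min (by positivity) (by linarith)
  obtain ⟨t, hNt, ht⟩ := exists_gridMesh_lt (n := n) W hε N
  obtain ⟨ht1, ht2⟩ := lt_min_iff.1 ht
  have hm := gridMesh_nonneg (n := n) t hW.le
  refine ⟨t, fun j _ => or_iff_not_imp_left.2 fun hj => ?_⟩
  rw [sq_lt_ratDistSq_iff (by linarith), not_lt] at hj
  have hjK : ratPoint (gridPoint n t c W j) ∈ K := by
    refine hj.trans ?_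
    exact_mod_cast (by linarith : R + gridMesh n t W ≤ (R + W) / 2)
  have hjU := hN hjK
  simp only [U, Set.mem_iUnion, Finset.mem_range, exists_prop, Metric.mem_ball] at hjU
  obtain ⟨i, hi, hd⟩ := hjU
  have ht1' : (gridMesh n t W : ℝ) < 1 / ((N : ℝ) + 1) := by
    have h0 : (gridMesh n t W : ℝ) < ((1 / ((N : ℚ) + 1) : ℚ) : ℝ) := Rat.cast_lt.2 ht1
    simpa using h0
  have h1 : gridMesh n t W < nonnegRatNum (p i).unpair.2 := by
    have := dist_nonneg.trans_lt hd
    exact_mod_cast (by linarith : (gridMesh n t W : ℝ) < nonnegRatNum (p i).unpair.2)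
  refine ⟨i, hi.trans_le hNt, h1, ?_⟩
  rw [ratDistSq_lt_sq_iff (by linarith)]
  push_cast
  linarith

end Certificates

/-! ### The first stage at which a search succeeds -/

/-- The first outcome of the search `o` among the stages before `t`. -/
def firstOutcome {σ : Type*} (o : ℕ → Option σ) (t : ℕ) : Option σ :=
  Nat.rec none (fun m r => r <|> o m) t

section FirstOutcome

variable {σ : Type*} {o o' : ℕ → Option σ}

theorem firstOutcome_succ (o : ℕ → Option σ) (t : ℕ) :
    firstOutcome o (t + 1) = (firstOutcome o t <|> o t) := rfl

theorem firstOutcome_congr {t : ℕ} (h : ∀ m < t, o m = o' m) :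
    firstOutcome o t = firstOutcome o' t := by
  induction t with
  | zero => rfl
  | succ t ih =>
    rw [firstOutcome_succ, firstOutcome_succ, ih fun m hm => h m (hm.trans (Nat.lt_succ_self t)),
      h t (Nat.lt_succ_self t)]

theorem firstOutcome_mono {t t' : ℕ} (htt : t ≤ t') {v : σ} (h : firstOutcome o t = some v) :
    firstOutcome o t' = some v := by
  induction t', htt using Nat.le_induction with
  | base => exact h
  | succ t' _ ih => rw [firstOutcome_succ, ih]; rfl

theorem exists_of_firstOutcome {t : ℕ} {v : σ} (h : firstOutcome o t = some v) :
    ∃ m, o m = some v := by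
  induction t with
  | zero => cases h
  | succ t ih =>
    rw [firstOutcome_succ] at h
    cases hv : firstOutcome o t with
    | none => rw [hv] at h; exact ⟨t, h⟩
    | some w => rw [hv] at h; exact ih (hv.trans h)

theorem exists_firstOutcome {m : ℕ} (h : (o m).isSome) :
    ∃ v, firstOutcome o (m + 1) = some v := by
  rw [firstOutcome_succ]
  cases hv : firstOutcome o m with
  | none => exact Option.isSome_iff_exists.1 h
  | some w => exact ⟨w, rfl⟩

end FirstOutcome

/-! ### Computability of the certificates -/

section Computability

variable {α : Type*} [Primcodable α]

theorem PrimrecPred.forall_lt_of {P : ℕ → α → Prop} (hP : PrimrecPred fun x : ℕ × α => P x.1 x.2)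
    {N : α → ℕ} (hN : Primrec N) : PrimrecPred fun a => ∀ j < N a, P j a := by
  have h : PrimrecRel fun (l : List ℕ) (a : α) => ∀ j ∈ l, P j a :=
    PrimrecRel.forall_mem_list (R := P) hP
  exact (h.comp (Primrec.list_range.comp hN) Primrec.id).of_eq fun a => by simp

theorem PrimrecPred.exists_lt_of {P : ℕ → α → Prop} (hP : PrimrecPred fun x : ℕ × α => P x.1 x.2)
    {N : α → ℕ} (hN : Primrec N) : PrimrecPred fun a => ∃ j < N a, P j a := by
  have h : PrimrecRel fun (l : List ℕ) (a : α) => ∃ j ∈ l, P j a :=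
    PrimrecRel.exists_mem_list (R := P) hP
  exact (h.comp (Primrec.list_range.comp hN) Primrec.id).of_eq fun a => by simp

theorem Primrec.pow_const {u : α → ℕ} (hu : Primrec u) (m : ℕ) : Primrec fun a => u a ^ m :=
  (Primrec₂.unpaired'.1 Nat.Primrec.pow).comp hu (Primrec.const m)

theorem PrimrecRat.ratDistSq {n : ℕ} {x y : α → Fin n → ℚ} (hx : ∀ i, PrimrecRat fun a => x a i)
    (hy : ∀ i, PrimrecRat fun a => y a i) : PrimrecRat fun a => ratDistSq (x a) (y a) :=
  PrimrecRat.sum Finset.univ fun i => ((hx i).sub (hy i)).sq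

theorem PrimrecRat.gridMesh (n : ℕ) {t : α → ℕ} (ht : Primrec t) {W : α → ℚ} (hW : PrimrecRat W) :
    PrimrecRat fun a => gridMesh n (t a) (W a) :=
  (PrimrecRat.const _).mul (((PrimrecRat.const 2).mul hW).mul (PrimrecRat.inv_natCast_succ ht))

theorem PrimrecRat.gridPoint {n : ℕ} {t j : α → ℕ} (ht : Primrec t) (hj : Primrec j) {W : α → ℚ}
    (hW : PrimrecRat W) {c : α → Fin n → ℚ} (hc : ∀ i, PrimrecRat fun a => c a i) (i : Fin n) :
    PrimrecRat fun a => gridPoint n (t a) (c a) (W a) (j a) i :=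
  ((hc i).sub hW).add ((((PrimrecRat.const 2).mul hW).mul (PrimrecRat.inv_natCast_succ ht)).mul
    (PrimrecRat.natCast (Primrec.nat_mod.comp
      (Primrec.nat_div.comp hj ((Primrec.succ.comp ht).pow_const i)) (Primrec.succ.comp ht))))

theorem PrimrecPred.isFarCertificate {n : ℕ} {p : α → Baire} (hp : Primrec₂ p) {t : α → ℕ}
    (ht : Primrec t) {c : α → Fin n → ℚ} (hc : ∀ i, PrimrecRat fun a => c a i) {R W : α → ℚ}
    (hR : PrimrecRat R) (hW : PrimrecRat W) :
    PrimrecPred fun a => IsFarCertificate n (p a) (t a) (c a) (R a) (W a) := by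
  refine PrimrecPred.forall_lt_of ?_ ((Primrec.succ.comp ht).pow_const n)
  have h1 : Primrec fun x : ℕ × α => x.2 := Primrec.snd
  have hg : ∀ i, PrimrecRat fun x : ℕ × α => _root_.gridPoint n (t x.2) (c x.2) (W x.2) x.1 i :=
    PrimrecRat.gridPoint (ht.comp h1) Primrec.fst (hW.comp h1) fun i => (hc i).comp h1
  have hm : PrimrecRat fun a => _root_.gridMesh n (t a) (W a) := PrimrecRat.gridMesh n ht hW
  refine PrimrecPred.or (((hR.add hm).sq.comp h1).lt
    (PrimrecRat.ratDistSq hg fun i => (hc i).comp h1)) ?_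
  refine PrimrecPred.exists_lt_of ?_ (ht.comp h1)
  have h2 : Primrec fun x : ℕ × ℕ × α => x.2 := Primrec.snd
  have h3 : Primrec fun x : ℕ × ℕ × α => x.2.2 := Primrec.snd.comp h2
  have h4 : Primrec fun x : ℕ × ℕ × α => (p x.2.2 x.1).unpair :=
    Primrec.unpair.comp (hp.comp h3 Primrec.fst)
  have hr : PrimrecRat fun x : ℕ × ℕ × α => nonnegRatNum (p x.2.2 x.1).unpair.2 :=
    PrimrecRat.nonnegRatNum_apply (Primrec.snd.comp h4)
  exact ((hm.comp h3).lt hr).and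
    ((PrimrecRat.ratDistSq (fun i => (hg i).comp h2)
      (PrimrecRat.ratVecNum_apply (Primrec.fst.comp h4))).lt (hr.sub (hm.comp h3)).sq)

theorem Primrec.firstOutcome {σ : Type*} [Primcodable σ] {o : α → ℕ → Option σ} (ho : Primrec₂ o)
    {t : α → ℕ} (ht : Primrec t) : Primrec fun a => firstOutcome (o a) (t a) :=
  Primrec.nat_rec' ht (Primrec.const none) (Primrec.option_orElse.comp₂
    ((Primrec.snd.comp Primrec.snd).to₂)
    ((ho.comp Primrec.fst (Primrec.fst.comp Primrec.snd)).to₂))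

end Computability

/-! ### The distance test -/

/-- The first component of a pair of sequences. -/
def Baire.fst (s : Baire) : Baire := fun i => s (2 * i)

/-- The second component of a pair of sequences. -/
def Baire.snd (s : Baire) : Baire := fun i => s (2 * i + 1)

theorem Baire.fst_pair (p q : Baire) : (Baire.pair p q).fst = p := funext (Baire.pair_even p q)

theorem Baire.snd_pair (p q : Baire) : (Baire.pair p q).snd = q := funext (Baire.pair_odd p q)

open Classical in
/-- Stage `t` of the test whether the point with number `b` is far from the closed set with the
name `s`: a certificate for the distance being at least `e₁ * 2⁻ᵏ` or for its being less than
`e₂ * 2⁻ᵏ` is looked for, where `k` is the integer with the number `a`, and `e` is a numerical function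
such that `e a` is the number of `e₂ * 2⁻ᵏ`. -/
noncomputable def distanceTest (n : ℕ) (e₁ e₂ : ℚ) (e : ℕ → ℕ) (s : Baire) (ab : ℕ × ℕ) (t : ℕ) :
    Option Bool :=
  if IsFarCertificate n s.fst t (ratVecNum n ab.2) (e₁ * 2 ^ (-intNum ab.1))
      (e₂ * 2 ^ (-intNum ab.1)) then some true
  else if ∃ i < t, s.snd i = Nat.pair ab.2 (e ab.1) + 1 then some false
  else none

section DistanceTest

variable {n : ℕ} {e₁ e₂ : ℚ} {e : ℕ → ℕ}

theorem distanceTest_primrec (n : ℕ) (e₁ e₂ : ℚ) (he : Primrec e) :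
    Primrec₂ fun (x : List ℕ × ℕ × ℕ) (t : ℕ) =>
      distanceTest n e₁ e₂ e (fun i => x.1.getD i 0) x.2 t := by
  classical
  have hx : Primrec fun y : (List ℕ × ℕ × ℕ) × ℕ => y.1 := Primrec.fst
  have hl : Primrec fun y : (List ℕ × ℕ × ℕ) × ℕ => y.1.1 := Primrec.fst.comp hx
  have ha : Primrec fun y : (List ℕ × ℕ × ℕ) × ℕ => y.1.2.1 :=
    Primrec.fst.comp (Primrec.snd.comp hx)
  have hb : Primrec fun y : (List ℕ × ℕ × ℕ) × ℕ => y.1.2.2 :=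
    Primrec.snd.comp (Primrec.snd.comp hx)
  have hp : Primrec₂ fun (y : (List ℕ × ℕ × ℕ) × ℕ) (i : ℕ) => y.1.1.getD (2 * i) 0 :=
    (Primrec.list_getD 0).comp (hl.comp Primrec.fst)
      (Primrec.nat_mul.comp (Primrec.const 2) Primrec.snd)
  have hs := PrimrecRat.two_zpow_neg ha
  refine Primrec.ite (PrimrecPred.isFarCertificate hp Primrec.snd
    (PrimrecRat.ratVecNum_apply hb) ((PrimrecRat.const e₁).mul hs) ((PrimrecRat.const e₂).mul hs))
    (Primrec.const _) (Primrec.ite (PrimrecPred.exists_lt_of ?_ Primrec.snd) (Primrec.const _)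
      (Primrec.const _))
  refine Primrec.eq.comp ?_ ?_
  · exact (Primrec.list_getD 0).comp (hl.comp Primrec.snd)
      (Primrec.succ.comp (Primrec.nat_mul.comp (Primrec.const 2) Primrec.fst))
  · exact Primrec.succ.comp (Primrec₂.natPair.comp (hb.comp Primrec.snd)
      (he.comp (ha.comp Primrec.snd)))

theorem IsFarCertificate.congr {p p' : Baire} {t : ℕ} (h : ∀ i < t, p i = p' i) (c : Fin n → ℚ)
    (R W : ℚ) : IsFarCertificate n p t c R W ↔ IsFarCertificate n p' t c R W :=
  forall₂_congr fun _ _ => or_congr Iff.rfl <|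
    exists_congr fun i => and_congr_right fun hi => by rw [h i hi]

/-- Stage t inspects t entries of each component, hence only the first 2t symbols of the name. This
is why `prefixTest` stops at half the length of the prefix and never meets the default value 0. -/
theorem distanceTest_congr {s s' : Baire} {ab : ℕ × ℕ} {t : ℕ} (h : ∀ i < 2 * t, s i = s' i) :
    distanceTest n e₁ e₂ e s ab t = distanceTest n e₁ e₂ e s' ab t := by
  classical
  exact if_congr (IsFarCertificate.congr (fun i hi => h (2 * i) (by omega)) _ _ _) rfl <|
    if_congr (exists_congr fun i => and_congr_right fun hi =>
      by rw [show s.snd i = s'.snd i from h (2 * i + 1) (by omega)]) rfl rfl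

/-- The outcome of the distance test on a finite prefix of a name. -/
noncomputable def prefixTest (n : ℕ) (e₁ e₂ : ℚ) (e : ℕ → ℕ) (l : List ℕ) (ab : ℕ × ℕ) :
    Option Bool :=
  firstOutcome (distanceTest n e₁ e₂ e (fun i => l.getD i 0) ab) (l.length / 2)

theorem prefixTest_primrec (n : ℕ) (e₁ e₂ : ℚ) (he : Primrec e) :
    Primrec₂ (prefixTest n e₁ e₂ e) :=
  Primrec.firstOutcome (distanceTest_primrec n e₁ e₂ he)
    (Primrec.nat_div.comp (Primrec.list_length.comp Primrec.fst) (Primrec.const 2))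

theorem prefixTest_take (s : Baire) (ab : ℕ × ℕ) (t : ℕ) :
    prefixTest n e₁ e₂ e (s.take t) ab = firstOutcome (distanceTest n e₁ e₂ e s ab) (t / 2) := by
  rw [prefixTest, Baire.length_take]
  exact firstOutcome_congr fun m hm => distanceTest_congr fun i hi =>
    Baire.getD_take (by omega)

variable {F : TopologicalSpace.Closeds (EuclideanSpace ℝ (Fin n))} {s : Baire}

theorem distanceTest_true (he₁ : 0 < e₁) (he : e₁ < e₂) (hs : (totalRep n).IsName s F)
    (hne : (F : Set (EuclideanSpace ℝ (Fin n))).Nonempty) {ab : ℕ × ℕ} {t : ℕ}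
    (h : distanceTest n e₁ e₂ e s ab t = some true) :
    (e₁ : ℝ) * 2 ^ (-intNum ab.1) ≤
      Metric.infDist (ratPoint (ratVecNum n ab.2)) (F : Set (EuclideanSpace ℝ (Fin n))) := by
  obtain ⟨p, q, rfl, hp, -⟩ := hs
  have h0 : (0 : ℚ) < 2 ^ (-intNum ab.1) := zpow_pos two_pos _
  rw [distanceTest] at h
  split_ifs at h with h1 h2
  · rw [Baire.fst_pair] at h1
    have := h1.le_infDist (mul_pos he₁ h0) (mul_le_mul_of_nonneg_right he.le h0.le) hne hp
    simpa using this
  · simp at h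

theorem distanceTest_false (hcode : ∀ a, nonnegRatNum (e a) = e₂ * 2 ^ (-intNum a))
    (hs : (totalRep n).IsName s F) {ab : ℕ × ℕ} {t : ℕ}
    (h : distanceTest n e₁ e₂ e s ab t = some false) :
    Metric.infDist (ratPoint (ratVecNum n ab.2)) (F : Set (EuclideanSpace ℝ (Fin n))) <
      (e₂ : ℝ) * 2 ^ (-intNum ab.1) := by
  obtain ⟨p, q, rfl, -, hq⟩ := hs
  rw [distanceTest] at h
  split_ifs at h with h1 h2
  · simp at h
  · rw [Baire.snd_pair] at h2
    obtain ⟨i, -, hi⟩ := h2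
    obtain ⟨y, hy, hyF⟩ := (hq _).1 ⟨i, hi⟩
    simp only [ratBall, Nat.unpair_pair, Metric.mem_ball, hcode] at hy
    rw [dist_comm] at hy
    push_cast at hy
    exact (Metric.infDist_le_dist_of_mem hyF).trans_lt hy

theorem exists_distanceTest (he₁ : 0 < e₁) (he : e₁ < e₂)
    (hcode : ∀ a, nonnegRatNum (e a) = e₂ * 2 ^ (-intNum a))
    (hs : (totalRep n).IsName s F) (ab : ℕ × ℕ) :
    ∃ t, (distanceTest n e₁ e₂ e s ab t).isSome := by
  obtain ⟨p, q, rfl, hp, hq⟩ := hs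
  have h0 : (0 : ℚ) < 2 ^ (-intNum ab.1) := zpow_pos two_pos _
  simp only [distanceTest]
  by_cases h : (ratBall n (Nat.pair ab.2 (e ab.1)) ∩ F).Nonempty
  · obtain ⟨i, hi⟩ := (hq _).2 h
    refine ⟨i + 1, ?_⟩
    have h1 : ∃ j < i + 1, (Baire.pair p q).snd j = Nat.pair ab.2 (e ab.1) + 1 :=
      ⟨i, Nat.lt_succ_self i, by rwa [Baire.snd_pair]⟩
    rw [if_pos h1]
    -- A far certificate may exist at the same stage; it takes precedence, and either outcome will
    -- do.
    split_ifs <;> rfl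
  · rw [Set.not_nonempty_iff_eq_empty] at h
    simp only [ratBall, Nat.unpair_pair, hcode] at h
    obtain ⟨t, ht⟩ := exists_isFarCertificate (mul_pos he₁ h0) (mul_lt_mul_of_pos_right he h0) hp h
    exact ⟨t, by rw [if_pos (by rwa [Baire.fst_pair])]; rfl⟩

/-- The value on which the distance test settles. -/
theorem exists_outcome (he₁ : 0 < e₁) (he : e₁ < e₂)
    (hcode : ∀ a, nonnegRatNum (e a) = e₂ * 2 ^ (-intNum a))
    (hs : (totalRep n).IsName s F) (hne : (F : Set (EuclideanSpace ℝ (Fin n))).Nonempty)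
    (ab : ℕ × ℕ) : ∃ v : Bool,
      (∀ t w, prefixTest n e₁ e₂ e (s.take t) ab = some w → w = v) ∧
      (∃ T, ∀ t, T ≤ t → prefixTest n e₁ e₂ e (s.take t) ab = some v) ∧
      (v = true → (e₁ : ℝ) * 2 ^ (-intNum ab.1) ≤
        Metric.infDist (ratPoint (ratVecNum n ab.2)) (F : Set (EuclideanSpace ℝ (Fin n)))) ∧
      (v = false → Metric.infDist (ratPoint (ratVecNum n ab.2))
        (F : Set (EuclideanSpace ℝ (Fin n))) < (e₂ : ℝ) * 2 ^ (-intNum ab.1)) := by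
  obtain ⟨T, hT⟩ := exists_distanceTest he₁ he hcode hs ab
  obtain ⟨v, hv⟩ := exists_firstOutcome hT
  obtain ⟨m, hm⟩ := exists_of_firstOutcome hv
  simp only [prefixTest_take]
  refine ⟨v, fun t w hw => ?_, ⟨2 * (T + 1), fun t ht => firstOutcome_mono (by omega) hv⟩, ?_, ?_⟩
  · have h1 := firstOutcome_mono (le_max_left (t / 2) (T + 1)) hw
    have h2 := firstOutcome_mono (le_max_right (t / 2) (T + 1)) hv
    exact Option.some.inj (h1.symm.trans h2)
  · rintro rfl
    exact distanceTest_true he₁ he hs hne hm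
  · rintro rfl
    exact distanceTest_false hcode hs hm

end DistanceTest

/-! ### Numbers of cubes and of their parents -/

section Codes

variable {n : ℕ}

/-- The numberings are surjective, so an unbounded search through all pairs inverts the coding. -/
theorem exists_decoding {ρ : ℤ × (Fin n → ℚ) ≃ ℕ} (hρ : IsComputableCoding ρ) :
    ∃ d : ℕ → ℕ × ℕ, Computable d ∧ ∀ m, ρ (intNum (d m).1, ratVecNum n (d m).2) = m := by
  obtain ⟨g, hg, H⟩ := hρ
  have hex : ∀ m, ∃ u : ℕ, g u.unpair.1 u.unpair.2 = m := fun m => by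
    obtain ⟨a, ha⟩ := intNum_surjective (ρ.symm m).1
    obtain ⟨b, hb⟩ := ratVecNum_surjective n (ρ.symm m).2
    exact ⟨Nat.pair a b, by simp [← H, ha, hb]⟩
  have hc : Computable fun m => Nat.find (hex m) := by
    have h1 : Computable₂ fun m u : ℕ => decide (g u.unpair.1 u.unpair.2 = m) :=
      (Primrec.eq (α := ℕ)).decide.to_comp.comp
        (hg.comp (Computable.fst.comp (Computable.unpair.comp Computable.snd))
          (Computable.snd.comp (Computable.unpair.comp Computable.snd))) Computable.fst
    refine (Partrec.rfind h1.partrec₂).of_eq_tot fun m => ?_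
    rw [Nat.mem_rfind]
    exact ⟨by simpa using Nat.find_spec (hex m), fun {u} hu => by simpa using Nat.find_min (hex m) hu⟩
  refine ⟨_, Computable.unpair.comp hc, fun m => ?_⟩
  rw [H]
  exact Nat.find_spec (hex m)

/-- The center of the parent of a dyadic cube, from the level and the center of the cube. -/
def parentCenter (k : ℤ) (c : Fin n → ℚ) : Fin n → ℚ := fun i =>
  ((⌊c i * 2 ^ (k - 1)⌋ : ℚ) + 1 / 2) * 2 ^ (-(k - 1))

/-- Rescaled to the parent's grid, the center has coordinates (a + 1/2)/2, whose floor is that of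
a/2: the added 1/2 never crosses an integer after halving. -/
theorem parentCenter_dyadicCenter (k : ℤ) (a : Fin n → ℤ) :
    parentCenter k (dyadicCenter k a) = dyadicCenter (k - 1) fun i => a i / 2 := funext fun i => by
  have h1 : ((a i : ℚ) + 1 / 2) * 2 ^ (-k) * 2 ^ (k - 1) = ((a i : ℚ) + 1 / 2) / 2 := by
    rw [mul_assoc, ← zpow_add₀ two_ne_zero, show -k + (k - 1) = -1 by ring, zpow_neg_one]
    rfl
  have h2 : ⌊((a i : ℚ) + 1 / 2) / 2⌋ = a i / 2 := by
    have h3 : ⌊((a i : ℚ) + 1 / 2) / ((2 : ℕ) : ℚ)⌋ = a i / 2 := by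
      rw [Int.floor_div_natCast, Int.floor_intCast_add]
      norm_num
    exact_mod_cast h3
  simp only [parentCenter, dyadicCenter, h1, h2]

theorem exists_parentCode (n : ℕ) : ∃ π : ℕ × ℕ → ℕ × ℕ, Primrec π ∧ ∀ ab,
    intNum (π ab).1 = intNum ab.1 - 1 ∧
      ratVecNum n (π ab).2 = parentCenter (intNum ab.1) (ratVecNum n ab.2) := by
  have hk : Primrec fun ab : ℕ × ℕ => Nat.pair ab.1.unpair.1 (ab.1.unpair.2 + 1) :=
    Primrec₂.natPair.comp (Primrec.fst.comp (Primrec.unpair.comp Primrec.fst))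
      (Primrec.succ.comp (Primrec.snd.comp (Primrec.unpair.comp Primrec.fst)))
  have hk' : ∀ ab : ℕ × ℕ,
      intNum (Nat.pair ab.1.unpair.1 (ab.1.unpair.2 + 1)) = intNum ab.1 - 1 := fun ab => by
    simp only [intNum, Nat.unpair_pair]; push_cast; ring
  have hc : ∀ i, PrimrecRat fun ab : ℕ × ℕ =>
      parentCenter (intNum ab.1) (ratVecNum n ab.2) i := fun i => by
    have h1 := PrimrecRat.two_zpow hk
    have h2 := PrimrecRat.two_zpow_neg hk
    simp only [hk'] at h1 h2
    exact ((((PrimrecRat.ratVecNum_apply Primrec.snd i).mul h1).floor).add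
      (PrimrecRat.const _)).mul h2
  obtain ⟨h, hh, H⟩ := PrimrecRat.exists_vecCode hc
  exact ⟨_, hk.pair hh, fun ab => ⟨hk' ab, H ab⟩⟩

end Codes

/-! ### The decomposition is computable -/

section Main

variable {n : ℕ}

/-- The numerical function that tells whether a cube passes the test and its parent does not, from
the outcomes of the two tests. -/
def selectBit (u v : Bool) : ℕ := if u && !v then 1 else 0

theorem selectBit_eq_one_iff {u v : Bool} : selectBit u v = 1 ↔ u = true ∧ ¬ v = true := by
  cases u <;> cases v <;> simp [selectBit]

/-- Strict inequalities at both ends turn the non-strict outcome "at least e₁2⁻ᵏ" into the strict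
bound required; the gap e₁ < e₂ is what the compactness argument needs. -/
theorem exists_thresholds (hn : 0 < n) : ∃ e₁ e₂ : ℚ, 0 < e₁ ∧ e₁ < e₂ ∧
    3 / 2 * √(n : ℝ) < e₁ ∧ (e₂ : ℝ) < 5 / 2 * √n := by
  have hs : 0 < √(n : ℝ) := Real.sqrt_pos.2 (by exact_mod_cast hn)
  obtain ⟨e₁, h1, h2⟩ := exists_rat_btwn (show 3 / 2 * √(n : ℝ) < 5 / 2 * √n by linarith)
  obtain ⟨e₂, h3, h4⟩ := exists_rat_btwn h2
  exact ⟨e₁, e₂, by exact_mod_cast (by linarith : (0 : ℝ) < e₁), by exact_mod_cast h3, h1, h4⟩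

theorem CUBE_nonempty (hn : 0 < n) {F : TopologicalSpace.Closeds (EuclideanSpace ℝ (Fin n))}
    (hne : (F : Set (EuclideanSpace ℝ (Fin n))).Nonempty) : (CUBE n F).Nonempty := by
  have hs : 0 < √(n : ℝ) := Real.sqrt_pos.2 (by exact_mod_cast hn)
  -- Without computability, the exact comparison with 3D/2 is an admissible test.
  refine ⟨_, maximalCubes_mem_CUBE (τ := fun k a => 3 / 2 * (√n * 2 ^ (-k)) <
    Metric.infDist (cubeCenter k a) (F : Set (EuclideanSpace ℝ (Fin n)))) ⟨id, fun h => ?_⟩ hn hne⟩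
  rename_i k a
  have : 0 < √(n : ℝ) * 2 ^ (-k) := by positivity
  linarith [not_lt.1 h]

theorem CUBE_isComputable (hn : 0 < n) {ρ : ℤ × (Fin n → ℚ) ≃ ℕ} (hρ : IsComputableCoding ρ) :
    Problem.IsComputable (totalRep n) (cubesRep ρ) (CUBE n) := by
  obtain ⟨e₁, e₂, he₁, he, hlow, hup⟩ := exists_thresholds hn
  obtain ⟨d, hd, hd'⟩ := exists_decoding hρ
  obtain ⟨π, hπ, hπ'⟩ := exists_parentCode n
  obtain ⟨g, hg, hg'⟩ := hρ
  obtain ⟨e, hep, hcode⟩ := ((PrimrecRat.const e₂).mul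
    (PrimrecRat.two_zpow_neg (Primrec.id (α := ℕ)))).exists_nonnegCode fun a => by
      have : (0 : ℚ) < 2 ^ (-intNum a) := zpow_pos two_pos _
      exact (mul_pos (he₁.trans he) this).le
  -- This is the number of the parent when m codes a dyadic cube. For other m it is some number, on
  -- which the test still settles, so that the output sequence is total.
  let par : ℕ → ℕ := fun m => g (π (d m)).1 (π (d m)).2
  have hpar : Computable par :=
    hg.comp (Computable.fst.comp (hπ.to_comp.comp hd)) (Computable.snd.comp (hπ.to_comp.comp hd))
  have htest : ∀ {δ : ℕ → ℕ × ℕ}, Computable δ →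
      Computable₂ fun (l : List ℕ) m => prefixTest n e₁ e₂ e l (δ m) := fun hδ =>
    (prefixTest_primrec n e₁ e₂ hep).to_comp.comp Computable.fst (hδ.comp Computable.snd)
  refine Problem.isComputable_of_determines
    (fun l m => (prefixTest n e₁ e₂ e l (d m)).bind fun u =>
      (prefixTest n e₁ e₂ e l (d (par m))).map fun v => selectBit u v) ?_ fun s F hs hF => ?_
  · refine Computable.option_bind (htest hd) ?_
    exact Computable.option_map ((htest (hd.comp hpar)).comp (Computable.fst.comp Computable.fst)
      (Computable.snd.comp Computable.fst))
      ((Primrec.dom_bool₂ selectBit).to_comp.comp (Computable.snd.comp Computable.fst)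
        Computable.snd)
  · obtain ⟨-, hne, -⟩ := hF
    -- The settled outcomes for this particular name form the test. Since they are indexed by codes,
    -- a cube consulted as a parent gets the same answer as when it is tested itself.
    choose τ hτ1 hτ2 hfar hnear using fun m => exists_outcome he₁ he hcode hs hne (d m)
    refine ⟨fun m => selectBit (τ m) (τ (par m)), fun m => ⟨fun t w hw => ?_, ?_⟩, ?_⟩
    · simp only [Option.bind_eq_some_iff, Option.map_eq_some_iff] at hw
      obtain ⟨u, hu, v, hv, rfl⟩ := hw
      rw [hτ1 _ _ _ hu, hτ1 _ _ _ hv]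
    · obtain ⟨T, hT⟩ := hτ2 m
      obtain ⟨T', hT'⟩ := hτ2 (par m)
      refine ⟨max T T', fun t ht => ?_⟩
      beta_reduce
      rw [hT t ((le_max_left _ _).trans ht), hT' t ((le_max_right _ _).trans ht)]
      rfl
    · have hdec : ∀ k (a : Fin n → ℤ), intNum (d (ρ (k, dyadicCenter k a))).1 = k ∧
          ratVecNum n (d (ρ (k, dyadicCenter k a))).2 = dyadicCenter k a := fun k a => by
        simpa only [Prod.mk.injEq] using ρ.injective (hd' (ρ (k, dyadicCenter k a)))
      have hparρ : ∀ k (a : Fin n → ℤ), par (ρ (k, dyadicCenter k a)) =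
          ρ (k - 1, dyadicCenter (k - 1) fun i => a i / 2) := fun k a => by
        simp only [par]
        rw [← hg', (hπ' _).1, (hπ' _).2, (hdec k a).1, (hdec k a).2, parentCenter_dyadicCenter]
      have hτ : IsDistanceTest (F : Set (EuclideanSpace ℝ (Fin n)))
          fun k a => τ (ρ (k, dyadicCenter k a)) = true := by
        constructor
        · intro k a h
          have h1 := hfar _ h
          rw [(hdec k a).1, (hdec k a).2] at h1
          have h2 : (0 : ℝ) < 2 ^ (-k) := zpow_pos two_pos _
          rw [← mul_assoc]
          exact (mul_lt_mul_of_pos_right hlow h2).trans_le h1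
        · intro k a h
          have h1 := hnear _ (Bool.not_eq_true _ ▸ h)
          rw [(hdec k a).1, (hdec k a).2] at h1
          have h2 : (0 : ℝ) < 2 ^ (-k) := zpow_pos two_pos _
          rw [← mul_assoc]
          exact h1.trans (mul_lt_mul_of_pos_right hup h2)
      refine ⟨_, maximalCubes_mem_CUBE hτ hn hne, ?_⟩
      simp only [cubesRep, selectBit_eq_one_iff, hparρ]
      rfl

theorem CUBE_zero_isComputable (ρ : ℤ × (Fin 0 → ℚ) ≃ ℕ) :
    Problem.IsComputable (totalRep 0) (cubesRep ρ) (CUBE 0) :=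
  Problem.isComputable_of_determines (fun _ _ => some 0) (Computable.const _) fun _ _ _ hF =>
    ⟨fun _ => 0, fun _ => ⟨fun _ _ h => (Option.some.inj h).symm, 0, fun _ _ => rfl⟩, ∅,
      empty_mem_CUBE_zero hF.choose_spec.1, by simp [cubesRep]⟩

end Main

theorem mainTheorem4 (n : ℕ) (ρ : ℤ × (Fin n → ℚ) ≃ ℕ) (hρ : IsComputableCoding ρ) :
    Problem.dom (CUBE n) =
        {F : TopologicalSpace.Closeds (EuclideanSpace ℝ (Fin n)) |
          (F : Set (EuclideanSpace ℝ (Fin n))).Nonempty} ∧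
      Problem.IsComputable (totalRep n) (cubesRep ρ) (CUBE n) := by
  rcases Nat.eq_zero_or_pos n with rfl | hn
  · exact ⟨dom_CUBE_of_exists fun _ hne => ⟨∅, empty_mem_CUBE_zero hne⟩, CUBE_zero_isComputable ρ⟩
  · exact ⟨dom_CUBE_of_exists fun _ hne => CUBE_nonempty hn hne, CUBE_isComputable hn hρ⟩
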